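/- Let $K$ be a field of characteristic $0$ that is complete with respect to a nontrivial nonarchimedean absolute value, and let $\mathbf{La}$ be the category of manifolds, i.e. of paracompact (Hausdorff) finite-dimensional locally $K$-analytic manifolds belonging to a fixed universe, with the locally $K$-analytic maps as morphisms. Equip $\mathbf{La}$ with the topology generated by open coverings, and let $y\colon \mathbf{La}\to \mathrm{Sh}(\mathbf{La})$ be the Yoneda embedding into the category of sheaves of sets. Let $G$ be a Lie group over $K$, i.e. a group object of $\mathbf{La}$, and let $BG$ be its classifying topos: the category of sheaves on $\mathbf{La}$ with an action of the sheaf of groups $y(G)$, with equivariant morphisms. Write $\Gamma(X,-)=\mathrm{Hom}_{BG}(X,-)$ for $X\in BG$, and $\Gamma=\Gamma(*,-)$ where $*$ is the terminal object. For an abelian group object $\mathcal A$ of $BG$ put $H^n(G,\mathcal A):=(R^n\Gamma)(\mathcal A)$, where $R^n\Gamma$ is the $n$-th right derived functor of $\Gamma$ from abelian group objects of $BG$ to abelian groups. Let $E_\bullet G$ be the simplicial manifold with $E_pG=G^{p+1}$, where a monotone map $\varphi\colon\{0<\dots<p\}\to\{0<\dots<q\}$ induces $E_qG\to E_pG$,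 $(g_0,\dots,g_q)\mapsto(g_{\varphi(0)},\dots,g_{\varphi(p)})$, and regard $y(E_\bullet G)$, with the diagonal action of $y(G)$ by left multiplication, as a simplicial object of $BG$. For an abelian group object $\mathcal A$ of $BG$, the sections $\Gamma(y(E_pG),\mathcal A)$, $p\ge 0$, form a cosimplicial abelian group $\Gamma(E_\bullet G,\mathcal A)$; let $H^n(\Gamma(E_\bullet G,\mathcal A))$ denote the $n$-th cohomology group of the associated cochain complex, whose differential is the alternating sum of the coface maps. Then for every $n\ge 0$ there is an isomorphism of abelian groups, natural in the abelian group object $\mathcal A$ of $BG$, $$H^n(G,\mathcal A)\;\cong\; H^n\big(\Gamma(E_\bullet G,\mathcal A)\big).$$ -/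

import Mathlib

open CategoryTheory Opposite
open scoped Manifold ContDiff

universe u

/-- A locally `K`-analytic manifold: a paracompact Hausdorff space with an analytic atlas
modelled on a finite-dimensional normed `K`-vector space. -/
structure AnMan (K : Type u) [NontriviallyNormedField K] where
  carrier : Type u
  model : Type u
  [normedAddCommGroup : NormedAddCommGroup model]
  [normedSpace : NormedSpace K model]
  [finiteDimensional : FiniteDimensional K model]
  [topologicalSpace : TopologicalSpace carrier]
  [t2Space : T2Space carrier]
  [paracompactSpace : ParacompactSpace carrier]
  [chartedSpace : ChartedSpace model carrier]
  [isManifold : IsManifold 𝓘(K, model) ω carrier]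

namespace AnMan

attribute [instance] normedAddCommGroup normedSpace finiteDimensional topologicalSpace t2Space
  paracompactSpace chartedSpace isManifold

variable {K : Type u} [NontriviallyNormedField K]

instance : CoeSort (AnMan K) (Type u) := ⟨AnMan.carrier⟩

/-- The category of manifolds and (locally `K`-analytic) maps. -/
instance : Category.{u} (AnMan K) where
  Hom X Y := C^ω⟮𝓘(K, X.model), X; 𝓘(K, Y.model), Y⟯
  id _ := ContMDiffMap.id
  comp f g := ContMDiffMap.comp g f

instance (X Y : AnMan K) : FunLike (X ⟶ Y) X Y :=
  inferInstanceAs (FunLike C^ω⟮𝓘(K, X.model), X; 𝓘(K, Y.model), Y⟯ X Y)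

/-- The morphism given by an analytic map. -/
def homMk {X Y : AnMan K} (f : X → Y) (hf : ContMDiff 𝓘(K, X.model) 𝓘(K, Y.model) ω f) :
    X ⟶ Y := (⟨f, hf⟩ : C^ω⟮𝓘(K, X.model), X; 𝓘(K, Y.model), Y⟯)

@[simp] theorem homMk_apply {X Y : AnMan K} (f : X → Y)
    (hf : ContMDiff 𝓘(K, X.model) 𝓘(K, Y.model) ω f) (x : X) : homMk f hf x = f x := rfl

@[simp] theorem id_apply (X : AnMan K) (x : X) : (𝟙 X : X ⟶ X) x = x := rfl

@[simp] theorem comp_apply {X Y Z : AnMan K} (f : X ⟶ Y) (g : Y ⟶ Z) (x : X) :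
    (f ≫ g) x = g (f x) := rfl

@[ext] theorem hom_ext {X Y : AnMan K} {f g : X ⟶ Y} (h : ∀ x, f x = g x) : f = g :=
  DFunLike.ext _ _ h

theorem contMDiff {X Y : AnMan K} (f : X ⟶ Y) : ContMDiff 𝓘(K, X.model) 𝓘(K, Y.model) ω f :=
  ContMDiffMap.contMDiff f

/-- Open embeddings that are isomorphisms of manifolds onto their image: injective local
analytic isomorphisms. -/
def IsOpenImmersion {Y X : AnMan K} (f : Y ⟶ X) : Prop :=
  Function.Injective f ∧ IsLocalDiffeomorph 𝓘(K, Y.model) 𝓘(K, X.model) ω f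

theorem IsOpenImmersion.comp {X Y Z : AnMan K} {f : X ⟶ Y} {g : Y ⟶ Z}
    (hf : IsOpenImmersion f) (hg : IsOpenImmersion g) : IsOpenImmersion (f ≫ g) :=
  ⟨hg.1.comp hf.1, fun x => (hf.2 x).comp (K := 𝓘(K, Z.model)) (hg := hg.2 (f x))⟩

/-- A function `h` with analytic `f ∘ h`, for `f` an open immersion, is analytic. -/
theorem IsOpenImmersion.lift {X Y Z : AnMan K} {f : Y ⟶ X} (hf : IsOpenImmersion f)
    (g : Z ⟶ X) (hg : ∀ z, ∃ y, f y = g z) : ∃ h : Z ⟶ Y, h ≫ f = g := by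
  choose h hh using hg
  refine ⟨homMk h fun z => ?_, hom_ext hh⟩
  obtain ⟨Φ, hz, he⟩ := hf.2 (h z)
  have hgz : g z ∈ Φ.target := by
    rw [← hh z, he hz]; exact Φ.map_source hz
  have h1 : ContMDiffAt 𝓘(K, Z.model) 𝓘(K, Y.model) ω (Φ.invFun ∘ g) z :=
    ((Φ.contMDiffOn_invFun).contMDiffAt (Φ.open_target.mem_nhds hgz)).comp z (contMDiff g z)
  refine h1.congr_of_eventuallyEq ?_
  filter_upwards [(contMDiff g).continuous.continuousAt.preimage_mem_nhds
    (Φ.open_target.mem_nhds hgz)] with w hw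
  apply hf.1
  rw [hh w, Function.comp_apply]
  exact ((he (Φ.map_target hw)).trans (Φ.right_inv hw)).symm

/-- A (paracompact) open subset of a manifold, as a manifold. -/
noncomputable def opens (X : AnMan K) (V : TopologicalSpace.Opens X) [ParacompactSpace V] :
    AnMan K where
  carrier := V
  model := X.model

/-- The inclusion of an open subset. -/
noncomputable def opensVal (X : AnMan K) (V : TopologicalSpace.Opens X) [ParacompactSpace V] :
    X.opens V ⟶ X :=
  ⟨fun v : V => v.1, contMDiff_subtype_val (I := 𝓘(K, X.model)) (U := V)⟩

theorem isOpenImmersion_opensVal (X : AnMan K) (V : TopologicalSpace.Opens X)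
    [ParacompactSpace V] : IsOpenImmersion (X.opensVal V) := by
  refine ⟨Subtype.val_injective, fun (y : V) => ?_⟩
  change IsLocalDiffeomorphAt 𝓘(K, X.model) 𝓘(K, X.model) ω (fun v : V => v.1) y
  classical
  refine ⟨{ toFun := fun v : V => v.1
            invFun := fun z => if h : z ∈ V then ⟨z, h⟩ else y
            source := Set.univ
            target := V
            map_source' := fun v _ => v.2
            map_target' := fun _ _ => Set.mem_univ _
            left_inv' := fun v _ => dif_pos v.2
            right_inv' := fun z hz => by
              rw [dif_pos (show z ∈ V from hz)]
            open_source := isOpen_univ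
            open_target := V.2
            contMDiffOn_toFun := contMDiff_subtype_val.contMDiffOn
            contMDiffOn_invFun := ?_ }, Set.mem_univ y, fun _ _ => rfl⟩
  intro z hz
  refine ContMDiffAt.contMDiffWithinAt ?_
  refine (ChartedSpace.liftPropWithinAt_subtypeVal_comp_iff
    (P := ContDiffWithinAtProp 𝓘(K, X.model) 𝓘(K, X.model) ω) _ _ _).1 ?_
  change ContMDiffAt 𝓘(K, X.model) 𝓘(K, X.model) ω _ z
  refine contMDiffAt_id.congr_of_eventuallyEq ?_
  filter_upwards [V.2.mem_nhds hz] with w hw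
  simp only [Function.comp_apply]
  rw [dif_pos (show w ∈ V from hw)]; rfl

/-- Every neighbourhood of a point contains an open submanifold around this point. -/
theorem exists_openImmersion {X : AnMan K} (x : X) (U : Set X) (hU : IsOpen U) (hx : x ∈ U) :
    ∃ (Y : AnMan K) (f : Y ⟶ X), IsOpenImmersion f ∧ x ∈ Set.range f ∧ Set.range f ⊆ U := by
  let e := chartAt X.model x
  let V : TopologicalSpace.Opens X := ⟨U ∩ e.source, hU.inter e.open_source⟩
  have hemb : Topology.IsEmbedding (fun v : V => e v.1) := by
    have h1 := e.isOpenEmbedding_restrict.isEmbedding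
    exact h1.comp (Topology.IsEmbedding.inclusion (s := (V : Set X)) (fun v hv => hv.2))
  have : TopologicalSpace.MetrizableSpace V := hemb.metrizableSpace
  have : ParacompactSpace V := by
    let := TopologicalSpace.metrizableSpaceMetric V
    infer_instance
  refine ⟨X.opens V, X.opensVal V, isOpenImmersion_opensVal X V,
    ⟨(⟨x, hx, mem_chart_source _ x⟩ : V), rfl⟩, ?_⟩
  rintro _ ⟨v, rfl⟩
  exact (show V from v).2.1

variable (K) in
/-- The topology generated by open coverings: a sieve is covering if it contains a family of
open embeddings with jointly surjective images. -/
def topology : GrothendieckTopology (AnMan K) where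
  sieves X := {S | ∀ x : X, ∃ (Y : AnMan K) (f : Y ⟶ X), S f ∧ IsOpenImmersion f ∧
    x ∈ Set.range f}
  top_mem' X x := by
    obtain ⟨Y, f, hf, hx, -⟩ := exists_openImmersion x Set.univ isOpen_univ (Set.mem_univ x)
    exact ⟨Y, f, trivial, hf, hx⟩
  pullback_stable' X Z S g hS z := by
    obtain ⟨Y, f, hSf, hf, y, hy⟩ := hS (g z)
    obtain ⟨W, i, hi, hz, hW⟩ := exists_openImmersion z (g ⁻¹' Set.range f)
      (hf.2.isOpen_range.preimage (contMDiff g).continuous) ⟨y, hy⟩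
    refine ⟨W, i, ?_, hi, hz⟩
    obtain ⟨h, hh⟩ := hf.lift (i ≫ g) (fun w => hW ⟨w, rfl⟩)
    change S (i ≫ g)
    rw [← hh]
    exact S.downward_closed hSf h
  transitive' X S hS R hR x := by
    obtain ⟨Y, f, hSf, hf, y, rfl⟩ := hS x
    obtain ⟨W, i, hi, hii, w, rfl⟩ := hR hSf y
    exact ⟨W, i ≫ f, hi, hii.comp hf, w, rfl⟩

/-- The one-point manifold. -/
def point (K : Type u) [NontriviallyNormedField K] : AnMan K where
  carrier := PUnit.{u + 1}
  model := PUnit.{u + 1}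

/-- Representable presheaves are sheaves. -/
instance : (topology K).Subcanonical := by
  refine GrothendieckTopology.Subcanonical.of_isSheaf_yoneda_obj _ fun G X S hS x' hx => ?_
  let x : ∀ {Y : AnMan K} (f : Y ⟶ X), S f → (Y ⟶ G) := fun f hf => x' f hf
  have key : ∀ {Y Y' : AnMan K} (f : Y ⟶ X) (f' : Y' ⟶ X) (hf : S f) (hf' : S f') (y : Y)
      (y' : Y'), f y = f' y' → x f hf y = x f' hf' y' := by
    intro Y Y' f f' hf hf' y y' h
    let c : point K ⟶ Y := homMk (fun _ => y) contMDiff_const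
    let c' : point K ⟶ Y' := homMk (fun _ => y') contMDiff_const
    have := hx c c' hf hf' (hom_ext fun _ => h)
    exact DFunLike.congr_fun (F := point K ⟶ G) this PUnit.unit
  choose Y f hSf hf y hy using hS
  let s : X → G := fun p => x (f p) (hSf p) (y p)
  have hs : ∀ {Z : AnMan K} (g : Z ⟶ X) (hg : S g) (z : Z), s (g z) = x g hg z :=
    fun g hg z => key _ _ _ _ _ _ (hy _)
  have hsm : ContMDiff 𝓘(K, X.model) 𝓘(K, G.model) ω s := by
    intro p
    obtain ⟨Φ, hz, he⟩ := (hf p).2 (y p)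
    have hp : p ∈ Φ.target := by
      have := Φ.map_source hz
      rwa [← show f p (y p) = Φ.toPartialEquiv (y p) from he hz, hy] at this
    have h1 : ContMDiffAt 𝓘(K, X.model) 𝓘(K, G.model) ω
        (x (f p) (hSf p) ∘ Φ.invFun) p :=
      (contMDiff _ _).comp p (Φ.contMDiffOn_invFun.contMDiffAt (Φ.open_target.mem_nhds hp))
    refine h1.congr_of_eventuallyEq ?_
    filter_upwards [Φ.open_target.mem_nhds hp] with w hw
    rw [Function.comp_apply, ← hs]
    exact congrArg s ((he (Φ.map_target hw)).trans (Φ.right_inv hw)).symm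
  refine ⟨homMk s hsm, fun Z g hg => hom_ext fun z => hs g hg z, fun t ht => hom_ext fun p => ?_⟩
  have := DFunLike.congr_fun (F := Y p ⟶ G) (ht (f p) (hSf p)) (y p)
  change (show X ⟶ G from t) (f p (y p)) = _ at this
  rw [hy] at this
  exact this

end AnMan

namespace AnMan

section Powers

variable {K : Type u} [NontriviallyNormedField K]

/-- The product charts on a finite power of a manifold. -/
noncomputable abbrev piCharts (ι : Type) [Fintype ι] (X : AnMan K) :
    ChartedSpace (ι → X.model) (ι → X) :=
  piChartedSpace (fun _ => X.model) (fun _ => X)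

attribute [local instance] piCharts

theorem contMDiff_pi_iff {ι : Type} [Fintype ι] {Y X : AnMan K} (f : Y → ι → X) :
    ContMDiff 𝓘(K, Y.model) 𝓘(K, ι → X.model) ω f ↔
      ∀ i, ContMDiff 𝓘(K, Y.model) 𝓘(K, X.model) ω (fun y => f y i) := by
  simp only [ContMDiff, contMDiffAt_iff]
  rw [forall_comm]
  refine forall_congr' fun y => ?_
  rw [forall_and, continuousAt_pi]
  refine and_congr Iff.rfl ?_
  rw [contDiffWithinAt_pi]
  rfl

theorem isManifold_pi (ι : Type) [Fintype ι] (X : AnMan K) :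
    IsManifold 𝓘(K, ι → X.model) ω (ι → X) := by
  refine isManifold_of_contDiffOn _ _ _ ?_
  rintro _ _ ⟨e, he, rfl⟩ ⟨e', he', rfl⟩
  rw [contDiffOn_pi]
  intro i
  have h := (mem_groupoid_of_pregroupoid.1
    (HasGroupoid.compatible (G := contDiffGroupoid ω 𝓘(K, X.model)) (he i trivial)
      (he' i trivial))).1
  have h' : ContDiffOn K ω ((e i).symm ≫ₕ (e' i)) ((e i).symm ≫ₕ (e' i)).source := by
    simpa [contDiffPregroupoid] using! h
  refine h'.comp (contDiff_apply K X.model i).contDiffOn ?_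
  rintro v ⟨hv, -⟩
  exact ⟨hv.1 i trivial, hv.2 i trivial⟩

end Powers
section LieGroups

variable {K : Type u} [NontriviallyNormedField K]

theorem firstCountable (X : AnMan K) : FirstCountableTopology X := by
  refine ⟨fun x => ?_⟩
  let e := chartAt X.model x
  have h : Filter.map e.symm (nhds (e x)) = nhds x := by
    rw [e.symm.map_nhds_eq (e.map_source (mem_chart_source _ x)),
      e.left_inv (mem_chart_source _ x)]
  rw [← h]
  infer_instance

variable (G : AnMan K) [Group G] [LieGroup 𝓘(K, G.model) ω G]

/-- Finite powers of a Lie group are metrizable, hence paracompact. -/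
theorem paracompactSpace_pi (ι : Type) [Fintype ι] : ParacompactSpace (ι → G) := by
  have := firstCountable G
  have : IsTopologicalGroup G := topologicalGroup_of_lieGroup 𝓘(K, G.model) ω
  let : UniformSpace (ι → G) := IsTopologicalGroup.rightUniformSpace (ι → G)
  have : (uniformity (ι → G)).IsCountablyGenerated := by
    change (Filter.comap (fun p : (ι → G) × (ι → G) => p.2 * p.1⁻¹) (nhds 1)).IsCountablyGenerated
    infer_instance
  let := UniformSpace.metricSpace (ι → G)
  infer_instance

attribute [local instance] piCharts in
/-- A finite power `G × ⋯ × G` of a Lie group, as a manifold. -/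
noncomputable def power (ι : Type) [Fintype ι] : AnMan K where
  carrier := ι → G
  model := ι → G.model
  paracompactSpace := paracompactSpace_pi G ι
  isManifold := isManifold_pi ι G

variable {G}

attribute [local instance] piCharts in
/-- An analytic map into a power of `G` given by its components. -/
def powerLift {ι : Type} [Fintype ι] {X : AnMan K} (f : ι → (X ⟶ G)) : X ⟶ power G ι :=
  ⟨fun x i => f i x, (contMDiff_pi_iff _).2 fun i => contMDiff (f i)⟩

attribute [local instance] piCharts in
/-- The projections of a power of `G`. -/
noncomputable def powerProj {ι : Type} [Fintype ι] (i : ι) : power G ι ⟶ G :=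
  ⟨fun x : ι → G => x i, (contMDiff_pi_iff (Y := power G ι) id).1 contMDiff_id i⟩

theorem power_ext {ι : Type} [Fintype ι] {X : AnMan K} {f g : X ⟶ power G ι}
    (h : ∀ i, f ≫ powerProj i = g ≫ powerProj i) : f = g := by
  ext x
  funext i
  exact DFunLike.congr_fun (h i) x

@[simp] theorem powerLift_proj {ι : Type} [Fintype ι] {X : AnMan K} (f : ι → (X ⟶ G)) (i : ι) :
    powerLift f ≫ powerProj i = f i := rfl

/-- The group of analytic maps `X ⟶ G`, with pointwise multiplication. -/
instance (X : AnMan K) : Group (X ⟶ G) :=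
  inferInstanceAs (Group C^ω⟮𝓘(K, X.model), X; 𝓘(K, G.model), G⟯)

theorem mul_apply {X : AnMan K} (f g : X ⟶ G) (x : X) : (f * g) x = f x * g x := rfl

@[simp] theorem comp_one {X Y : AnMan K} (f : X ⟶ Y) : f ≫ (1 : Y ⟶ G) = 1 := rfl

@[simp] theorem comp_mul {X Y : AnMan K} (f : X ⟶ Y) (g h : Y ⟶ G) :
    f ≫ (g * h) = (f ≫ g) * (f ≫ h) := rfl

variable (G)

/-- The simplicial manifold `E_• G` with `E_p G = G ^ (p + 1)`, where a monotone map `φ` acts by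
`(g_i)_i ↦ (g_{φ i})_i`. -/
noncomputable def E : SimplicialObject (AnMan K) where
  obj p := power G (Fin (p.unop.len + 1))
  map φ := powerLift fun i => powerProj (φ.unop.toOrderHom i)
  map_id _ := rfl
  map_comp _ _ := rfl

end LieGroups

end AnMan

open AnMan

section ClassifyingTopos

variable {K : Type u} [NontriviallyNormedField K]

/-- An object of the classifying topos `BG`: a sheaf of sets `F` on the site of manifolds with an
action `y(G) × F ⟶ F` of the sheaf of groups `y(G) = Hom(-, G)`. -/
structure ClassifyingTopos (G : AnMan K) [Group G] [LieGroup 𝓘(K, G.model) ω G] where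
  sheaf : Sheaf (topology K) (Type (u + 1))
  act : ∀ {X : AnMan K}, (X ⟶ G) → sheaf.obj.obj (op X) → sheaf.obj.obj (op X)
  one_act : ∀ {X : AnMan K} (s : sheaf.obj.obj (op X)), act 1 s = s
  mul_act : ∀ {X : AnMan K} (g h : X ⟶ G) (s : sheaf.obj.obj (op X)),
    act (g * h) s = act g (act h s)
  map_act : ∀ {X Y : AnMan K} (f : Y ⟶ X) (g : X ⟶ G) (s : sheaf.obj.obj (op X)),
    sheaf.obj.map f.op (act g s) = act (f ≫ g) (sheaf.obj.map f.op s)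

variable {G : AnMan K} [Group G] [LieGroup 𝓘(K, G.model) ω G]

namespace ClassifyingTopos

/-- Morphisms of `BG`: equivariant morphisms of sheaves. -/
@[ext]
structure Hom (A B : ClassifyingTopos G) where
  hom : A.sheaf ⟶ B.sheaf
  map_act : ∀ {X : AnMan K} (g : X ⟶ G) (s : A.sheaf.obj.obj (op X)),
    hom.hom.app (op X) (A.act g s) = B.act g (hom.hom.app (op X) s)

instance : Category (ClassifyingTopos G) where
  Hom := Hom
  id A := ⟨𝟙 _, fun _ _ => rfl⟩
  comp f g := ⟨f.hom ≫ g.hom, fun a s =>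
    (congrArg (g.hom.hom.app _) (f.map_act a s)).trans (g.map_act a _)⟩

/-- The value of a morphism of `BG` on a section over `X`. -/
def app {A B : ClassifyingTopos G} (f : A ⟶ B) {X : AnMan K} (s : A.sheaf.obj.obj (op X)) :
    B.sheaf.obj.obj (op X) := (Hom.hom f).hom.app (op X) s

@[simp] theorem id_app (A : ClassifyingTopos G) {X : AnMan K} (s : A.sheaf.obj.obj (op X)) :
    app (𝟙 A) s = s := rfl

@[simp] theorem comp_app {A B C : ClassifyingTopos G} (f : A ⟶ B) (g : B ⟶ C) {X : AnMan K}
    (s : A.sheaf.obj.obj (op X)) : app (f ≫ g) s = app g (app f s) := rfl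

theorem app_act {A B : ClassifyingTopos G} (f : A ⟶ B) {X : AnMan K} (g : X ⟶ G)
    (s : A.sheaf.obj.obj (op X)) : app f (A.act g s) = B.act g (app f s) := Hom.map_act f g s

theorem app_map {A B : ClassifyingTopos G} (f : A ⟶ B) {X Y : AnMan K} (i : Y ⟶ X)
    (s : A.sheaf.obj.obj (op X)) :
    app f (A.sheaf.obj.map i.op s) = B.sheaf.obj.map i.op (app f s) :=
  NatTrans.naturality_apply (Hom.hom f).hom i.op s

theorem hom_ext' {A B : ClassifyingTopos G} {f g : A ⟶ B}
    (h : ∀ {X : AnMan K} (s : A.sheaf.obj.obj (op X)), app f s = app g s) : f = g := by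
  refine Hom.ext ?_
  ext X s
  exact h s

/-- A morphism of `BG` from its values on sections. -/
def homMk' {A B : ClassifyingTopos G}
    (φ : ∀ {X : AnMan K}, A.sheaf.obj.obj (op X) → B.sheaf.obj.obj (op X))
    (hmap : ∀ {X Y : AnMan K} (i : Y ⟶ X) (s : A.sheaf.obj.obj (op X)),
      φ (A.sheaf.obj.map i.op s) = B.sheaf.obj.map i.op (φ s))
    (hact : ∀ {X : AnMan K} (g : X ⟶ G) (s : A.sheaf.obj.obj (op X)),
      φ (A.act g s) = B.act g (φ s)) : A ⟶ B where
  hom := ObjectProperty.homMk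
    { app := fun X => TypeCat.ofHom (φ (X := X.unop))
      naturality := fun X Y i => by
        ext s
        exact hmap i.unop s }
  map_act := hact

@[simp] theorem homMk'_app {A B : ClassifyingTopos G}
    (φ : ∀ {X : AnMan K}, A.sheaf.obj.obj (op X) → B.sheaf.obj.obj (op X)) (hmap) (hact)
    {X : AnMan K} (s : A.sheaf.obj.obj (op X)) :
    app (homMk' (A := A) (B := B) φ hmap hact) s = φ s := rfl

variable (G) in
/-- The terminal object `*` of `BG`: the one-point sheaf. -/
def terminal : ClassifyingTopos G where
  sheaf := Sheaf.terminal (topology K) Limits.Types.isTerminalPUnit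
  act _ s := s
  one_act _ := rfl
  mul_act _ _ _ := rfl
  map_act _ _ _ := rfl

/-- `terminal G` is a terminal object. -/
def isTerminalTerminal : Limits.IsTerminal (terminal G) :=
  Limits.IsTerminal.ofUniqueHom
    (fun _ => homMk' (fun _ => PUnit.unit) (fun _ _ => rfl) (fun _ _ => rfl))
    (fun _ _ => hom_ext' fun _ => rfl)

/-- The object `y(E_p G)` of `BG`, with `G` acting diagonally by left multiplication. -/
noncomputable def EObj (p : SimplexCategoryᵒᵖ) : ClassifyingTopos G where
  sheaf := (topology K).uliftYoneda.{u + 1}.obj ((E G).obj p)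
  act g s := ULift.up (powerLift fun i => g * (s.down ≫ powerProj i))
  one_act s := by
    refine ULift.ext _ _ (power_ext fun i => ?_)
    exact one_mul (s.down ≫ powerProj i)
  mul_act g h s := by
    refine ULift.ext _ _ (power_ext fun i => ?_)
    exact mul_assoc g h (s.down ≫ powerProj i)
  map_act _ _ _ := rfl

variable (G) in
/-- The simplicial object `y(E_• G)` of `BG`. -/
noncomputable def simplicialE : SimplicialObject (ClassifyingTopos G) where
  obj p := EObj p
  map φ :=
    { hom := (topology K).uliftYoneda.{u + 1}.map ((E G).map φ)
      map_act := fun _ _ => rfl }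
  map_id _ := rfl
  map_comp _ _ := rfl

end ClassifyingTopos

/-- An abelian group object of `BG`: an object `A` of `BG` with an abelian group structure on its
sections such that addition `A × A ⟶ A` is a morphism of `BG`. -/
structure AbObject (G : AnMan K) [Group G] [LieGroup 𝓘(K, G.model) ω G] extends
    ClassifyingTopos G where
  [addCommGroup : ∀ X : AnMan K, AddCommGroup (sheaf.obj.obj (op X))]
  map_add : ∀ {X Y : AnMan K} (f : Y ⟶ X) (s t : sheaf.obj.obj (op X)),
    sheaf.obj.map f.op (s + t) = sheaf.obj.map f.op s + sheaf.obj.map f.op t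
  act_add : ∀ {X : AnMan K} (g : X ⟶ G) (s t : sheaf.obj.obj (op X)),
    act g (s + t) = act g s + act g t

namespace AbObject

open ClassifyingTopos

attribute [instance] addCommGroup

/-- The sections of `A` over a manifold. -/
abbrev sec (A : AbObject G) (X : AnMan K) : Type (u + 1) := A.sheaf.obj.obj (op X)

/-- The restriction of sections, as a group homomorphism. -/
def res (A : AbObject G) {X Y : AnMan K} (f : Y ⟶ X) : A.sec X →+ A.sec Y :=
  AddMonoidHom.mk' (fun s => A.sheaf.obj.map f.op s) (A.map_add f)

/-- The action on sections, as a group homomorphism. -/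
def actHom (A : AbObject G) {X : AnMan K} (g : X ⟶ G) : A.sec X →+ A.sec X :=
  AddMonoidHom.mk' (fun s => A.act g s) (A.act_add g)

section HomGroup

variable {B : ClassifyingTopos G} {A : AbObject G}

/-- Morphisms of `BG` into an abelian group object are added pointwise. -/
instance : Add (B ⟶ A.toClassifyingTopos) where
  add f g := homMk' (fun {X} s => (app f s + app g s : A.sec X))
    (fun i s => by
      rw [app_map, app_map]; exact (A.map_add i _ _).symm)
    (fun h s => by
      rw [app_act, app_act]; exact (A.act_add h _ _).symm)

instance : Zero (B ⟶ A.toClassifyingTopos) where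
  zero := homMk' (fun {X} _ => (0 : A.sec X)) (fun i _ => (map_zero (A.res i)).symm)
    (fun h _ => (map_zero (A.actHom h)).symm)

instance : Neg (B ⟶ A.toClassifyingTopos) where
  neg f := homMk' (fun {X} s => (-(app f s) : A.sec X))
    (fun i s => by
      rw [app_map]; exact (_root_.map_neg (A.res i) _).symm)
    (fun h s => by
      rw [app_act]; exact (_root_.map_neg (A.actHom h) _).symm)

theorem add_app (f g : B ⟶ A.toClassifyingTopos) {X : AnMan K} (s : B.sheaf.obj.obj (op X)) :
    app (f + g) s = (app f s + app g s : A.sec X) := rfl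

theorem zero_app {X : AnMan K} (s : B.sheaf.obj.obj (op X)) :
    app (0 : B ⟶ A.toClassifyingTopos) s = (0 : A.sec X) := rfl

theorem neg_app (f : B ⟶ A.toClassifyingTopos) {X : AnMan K} (s : B.sheaf.obj.obj (op X)) :
    app (-f) s = (-(app f s) : A.sec X) := rfl

instance : AddCommGroup (B ⟶ A.toClassifyingTopos) where
  add_assoc f g h := hom_ext' fun {X} s => add_assoc (G := A.sec X) _ _ _
  zero_add f := hom_ext' fun {X} s => zero_add (M := A.sec X) _
  add_zero f := hom_ext' fun {X} s => add_zero (M := A.sec X) _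
  nsmul := nsmulRec
  zsmul := zsmulRec
  neg_add_cancel f := hom_ext' fun {X} s => neg_add_cancel (G := A.sec X) _
  add_comm f g := hom_ext' fun {X} s => add_comm (G := A.sec X) _ _

end HomGroup

/-- Morphisms of abelian group objects of `BG`: additive morphisms of `BG`. -/
@[ext]
structure Hom (A B : AbObject G) where
  hom : A.toClassifyingTopos ⟶ B.toClassifyingTopos
  map_add : ∀ {X : AnMan K} (s t : A.sec X),
    app hom (s + t) = (app hom s + app hom t : B.sec X)

instance : Category (AbObject G) where
  Hom := Hom
  id A := ⟨𝟙 _, fun _ _ => rfl⟩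
  comp f g := ⟨f.hom ≫ g.hom, fun s t => by
    rw [comp_app, f.map_add, g.map_add]; rfl⟩

/-- The underlying morphism of `BG`. -/
def toBG {A B : AbObject G} (f : A ⟶ B) : A.toClassifyingTopos ⟶ B.toClassifyingTopos := f.hom

@[simp] theorem toBG_id (A : AbObject G) : toBG (𝟙 A) = 𝟙 _ := rfl

@[simp] theorem toBG_comp {A B C : AbObject G} (f : A ⟶ B) (g : B ⟶ C) :
    toBG (f ≫ g) = toBG f ≫ toBG g := rfl

theorem toBG_injective {A B : AbObject G} {f g : A ⟶ B} (h : toBG f = toBG g) : f = g :=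
  Hom.ext h

theorem toBG_add {A B : AbObject G} (f : A ⟶ B) {X : AnMan K} (s t : A.sec X) :
    app (toBG f) (s + t) = (app (toBG f) s + app (toBG f) t : B.sec X) := f.map_add s t

/-- The map on sections over `X`, as a group homomorphism. -/
def secHom {A B : AbObject G} (f : A ⟶ B) (X : AnMan K) : A.sec X →+ B.sec X :=
  AddMonoidHom.mk' (fun s => app (toBG f) s) (toBG_add f)

instance (A B : AbObject G) : Add (A ⟶ B) where
  add f g := ⟨toBG f + toBG g, fun {X} s t => by
    rw [add_app, add_app, add_app, toBG_add, toBG_add]; exact add_add_add_comm (G := B.sec X) _ _ _ _⟩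

instance (A B : AbObject G) : Zero (A ⟶ B) where
  zero := ⟨0, fun {X} _ _ => (add_zero (M := B.sec X) _).symm⟩

instance (A B : AbObject G) : Neg (A ⟶ B) where
  neg f := ⟨-toBG f, fun {X} s t => by
    rw [neg_app, neg_app, neg_app, toBG_add]; exact neg_add (α := B.sec X) _ _⟩

instance (A B : AbObject G) : AddCommGroup (A ⟶ B) where
  add_assoc f g h := toBG_injective (add_assoc (toBG f) (toBG g) (toBG h))
  zero_add f := toBG_injective (zero_add (toBG f))
  add_zero f := toBG_injective (add_zero (toBG f))
  nsmul := nsmulRec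
  zsmul := zsmulRec
  neg_add_cancel f := toBG_injective (neg_add_cancel (toBG f))
  add_comm f g := toBG_injective (add_comm (toBG f) (toBG g))

theorem add_toBG {A B : AbObject G} (f g : A ⟶ B) : toBG (f + g) = toBG f + toBG g := rfl

instance : Preadditive (AbObject G) where
  add_comp A B C f f' g := toBG_injective (hom_ext' fun {X} s => by
    change app (toBG g) (app (toBG f) s + app (toBG f') s : B.sec X) = _
    rw [toBG_add]; rfl)
  comp_add A B C f g g' := rfl

end AbObject

/-! The category of abelian group objects of `BG` is abelian with enough injectives: it is
equivalent to the category of abelian sheaves on an auxiliary site. -/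

/-- The auxiliary site: manifolds with morphisms `X ⟶ Y` the pairs of a map `X ⟶ G` and a map
`X ⟶ Y`. (This is the full subcategory of `BG` on the objects `y(G) × y(X)`.) -/
structure ActSite (G : AnMan K) where
  base : AnMan K

namespace ActSite

/-- Morphisms of the auxiliary site. -/
@[ext]
structure Hom (X Y : ActSite G) where
  tw : X.base ⟶ G
  map : X.base ⟶ Y.base

instance : Category.{u} (ActSite G) where
  Hom := Hom
  id _ := ⟨1, 𝟙 _⟩
  comp a b := ⟨a.tw * (a.map ≫ b.tw), a.map ≫ b.map⟩
  id_comp _ := Hom.ext (one_mul _) rfl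
  comp_id _ := Hom.ext (mul_one _) rfl
  assoc _ _ _ := Hom.ext (mul_assoc _ _ _) rfl

variable (G) in
/-- The inclusion of the site of manifolds. -/
def incl : AnMan K ⥤ ActSite G where
  obj X := ⟨X⟩
  map f := ⟨1, f⟩
  map_comp f g := Hom.ext (one_mul (1 : _ ⟶ G)).symm rfl

/-- The twist of an object by a map to `G`. -/
def twist (X : ActSite G) (g : X.base ⟶ G) : X ⟶ X := ⟨g, 𝟙 _⟩

theorem eq_twist_comp {X Y : ActSite G} (a : X ⟶ Y) :
    a = twist X a.tw ≫ (incl G).map a.map := Hom.ext (mul_one _).symm rfl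

theorem twist_mul (X : ActSite G) (g h : X.base ⟶ G) :
    twist X (g * h) = twist X g ≫ twist X h := rfl

theorem twist_one (X : ActSite G) : twist X 1 = 𝟙 X := rfl

theorem incl_comp_twist {X Y : AnMan K} (f : Y ⟶ X) (g : X ⟶ G) :
    (incl G).map f ≫ twist ⟨X⟩ g = twist ⟨Y⟩ (f ≫ g) ≫ (incl G).map f :=
  Hom.ext ((one_mul (f ≫ g)).trans (mul_one (f ≫ g)).symm) rfl

theorem map_map (P : (ActSite G)ᵒᵖ ⥤ Type (u + 1)) {X Y Z : ActSite G} {a : Y ⟶ X} {b : Z ⟶ Y}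
    {c : Z ⟶ X} (h : b ≫ a = c) (s : P.obj (op X)) : P.map b.op (P.map a.op s) = P.map c.op s := by
  subst h
  rw [op_comp, P.map_comp]; rfl

theorem map_map' (P : (ActSite G)ᵒᵖ ⥤ AddCommGrpCat.{u + 1}) {X Y Z : ActSite G} {a : Y ⟶ X}
    {b : Z ⟶ Y} {c : Z ⟶ X} (h : b ≫ a = c) (s : P.obj (op X)) :
    P.map b.op (P.map a.op s) = P.map c.op s := by
  subst h
  rw [op_comp, P.map_comp]; rfl

variable (G) in
/-- The topology on the auxiliary site. -/
def topology : GrothendieckTopology (ActSite G) where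
  sieves X := {S | Sieve.functorPullback (X := X.base) (incl G) S ∈ AnMan.topology K X.base}
  top_mem' X := (AnMan.topology K).top_mem X.base
  pullback_stable' X Z S a hS := by
    have h := (AnMan.topology K).pullback_stable a.map hS
    refine (AnMan.topology K).superset_covering ?_ h
    intro W f hf
    change S ((incl G).map f ≫ a)
    have : (incl G).map f ≫ a =
        twist (⟨W⟩ : ActSite G) (f ≫ a.tw) ≫ (incl G).map (f ≫ a.map) :=
      Hom.ext ((one_mul (f ≫ a.tw)).trans (mul_one (f ≫ a.tw)).symm) rfl
    rw [this]
    exact S.downward_closed hf _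
  transitive' X S hS R hR := by
    refine (AnMan.topology K).transitive hS _ fun W f hf => ?_
    refine (AnMan.topology K).superset_covering ?_ (hR hf)
    intro V i hi
    change R ((incl G).map (i ≫ f))
    rw [Functor.map_comp]
    exact hi

/-- A presheaf on the auxiliary site is a sheaf iff its restriction to manifolds is. -/
theorem isSheaf_iff (P : (ActSite G)ᵒᵖ ⥤ Type (u + 1)) :
    Presieve.IsSheaf (topology G) P ↔ Presieve.IsSheaf (AnMan.topology K) ((incl G).op ⋙ P) := by
  constructor
  · intro hP X S hS x hx
    -- the sieve generated by the image of `S`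
    let S' : Sieve ((incl G).obj X) :=
      { arrows := fun W a => S (Hom.map a)
        downward_closed := fun {W V a} ha b => S.downward_closed ha (Hom.map b) }
    have hS' : S' ∈ topology G ((incl G).obj X) := hS
    let x' : Presieve.FamilyOfElements P S'.arrows := fun W a ha =>
      P.map (twist W a.tw).op (x (Hom.map a) ha)
    have hx' : x'.Compatible := by
      rw [Presieve.compatible_iff_sieveCompatible]
      intro W V a b ha
      have h := (Presieve.compatible_iff_sieveCompatible x).1 hx (Hom.map a) (Hom.map b) ha
      change P.map (twist V (b ≫ a).tw).op (x (Hom.map b ≫ Hom.map a) _) =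
        P.map b.op (P.map (twist W a.tw).op (x (Hom.map a) ha))
      rw [h]
      refine (map_map P (a := (incl G).map (Hom.map b)) (b := twist V (b ≫ a).tw)
        (c := b ≫ twist W a.tw) (Hom.ext (mul_one _) rfl) _).trans ?_
      exact (map_map P rfl _).symm
    obtain ⟨t, ht, hu⟩ := hP S' hS' x' hx'
    have key : ∀ t : P.obj (op ((incl G).obj X)),
        x.IsAmalgamation (P := (incl G).op ⋙ P) t ↔ x'.IsAmalgamation t := by
      intro t
      constructor
      · intro h W a ha
        change _ = P.map (twist W a.tw).op (x (Hom.map a) ha)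
        rw [← h (Hom.map a) ha]
        exact (map_map P (a := (incl G).map (Hom.map a)) (eq_twist_comp a).symm t).symm
      · intro h W f hf
        refine (h ((incl G).map f) hf).trans ?_
        change P.map (𝟙 _) _ = _
        rw [P.map_id]
        rfl
    exact ⟨t, (key t).2 ht, fun s hs => hu s ((key s).1 hs)⟩
  · intro hP X S hS x hx
    let x' : Presieve.FamilyOfElements ((incl G).op ⋙ P)
        (Sieve.functorPullback (X := X.base) (incl G) S).arrows := fun W f hf =>
      x ((incl G).map f) hf
    have hxs := (Presieve.compatible_iff_sieveCompatible x).1 hx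
    have hx' : x'.Compatible := by
      rw [Presieve.compatible_iff_sieveCompatible]
      intro W V f i hf
      have := hxs ((incl G).map f) ((incl G).map i) hf
      refine Eq.trans ?_ this
      change x ((incl G).map (i ≫ f)) _ = _
      congr 1
      exact CategoryTheory.Functor.map_comp _ _ _
    obtain ⟨t, ht, hu⟩ := hP _ hS x' hx'
    have key : ∀ t : P.obj (op X), x'.IsAmalgamation (P := (incl G).op ⋙ P) t ↔
        x.IsAmalgamation t := by
      intro t
      constructor
      · intro h W a ha
        have ha' : S ((incl G).map (Hom.map a)) := by
          have : (incl G).map (Hom.map a) = twist W (a.tw)⁻¹ ≫ a :=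
            Hom.ext (inv_mul_cancel a.tw).symm rfl
          rw [this]
          exact S.downward_closed ha _
        have h1 := h (Hom.map a) ha'
        change P.map ((incl G).map (Hom.map a)).op t = x _ ha' at h1
        have h2 := hxs ((incl G).map (Hom.map a)) (twist W a.tw) ha'
        rw [← h1] at h2
        refine (map_map P (a := (incl G).map (Hom.map a)) (eq_twist_comp a).symm t).symm.trans
          (h2.symm.trans ?_)
        congr 1
        exact (eq_twist_comp a).symm
      · intro h W f hf
        exact h ((incl G).map f) hf
    exact ⟨t, (key t).1 ht, fun s hs => hu s ((key s).2 hs)⟩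

end ActSite

namespace AbObject

open ClassifyingTopos ActSite

/-- The presheaf on the auxiliary site attached to an abelian group object. -/
def toPresheaf (A : AbObject G) : (ActSite G)ᵒᵖ ⥤ AddCommGrpCat.{u + 1} where
  obj X := AddCommGrpCat.of (A.sec X.unop.base)
  map a := AddCommGrpCat.ofHom ((A.actHom (ActSite.Hom.tw a.unop)).comp (A.res (ActSite.Hom.map a.unop)))
  map_id X := by
    ext s
    change A.act 1 (A.sheaf.obj.map (𝟙 _) s) = s
    rw [A.one_act, CategoryTheory.Functor.map_id]; rfl
  map_comp a b := by
    ext s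
    change A.act (_ * _) (A.sheaf.obj.map ((ActSite.Hom.map a.unop).op ≫ (ActSite.Hom.map b.unop).op) s) =
      A.act _ (A.sheaf.obj.map _ (A.act _ (A.sheaf.obj.map _ s)))
    rw [A.mul_act, A.map_act, CategoryTheory.Functor.map_comp]
    rfl

theorem isSheaf_toPresheaf (A : AbObject G) :
    Presheaf.IsSheaf (ActSite.topology G) A.toPresheaf := by
  rw [Presheaf.isSheaf_iff_isSheaf_forget _ _ (forget AddCommGrpCat.{u + 1}),
    isSheaf_iff_isSheaf_of_type, ActSite.isSheaf_iff]
  have h := (isSheaf_iff_isSheaf_of_type _ _).1 A.sheaf.property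
  let e : A.sheaf.obj ≅ (incl G).op ⋙ A.toPresheaf ⋙ forget AddCommGrpCat.{u + 1} :=
    NatIso.ofComponents (fun X => Iso.refl (A.sheaf.obj.obj X)) (by
      intro X Y f
      ext s
      exact (A.one_act _).symm)
  exact Presieve.isSheaf_iso _ e h

variable (G) in
/-- The functor from abelian group objects of `BG` to abelian sheaves on the auxiliary site. -/
def toSheaf : AbObject G ⥤ Sheaf (ActSite.topology G) AddCommGrpCat.{u + 1} where
  obj A := ⟨A.toPresheaf, A.isSheaf_toPresheaf⟩
  map {A B} f := ObjectProperty.homMk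
    { app := fun X => AddCommGrpCat.ofHom (secHom f X.unop.base)
      naturality := fun X Y a => by
        ext s
        change app (toBG f) (A.act _ (A.sheaf.obj.map _ s)) =
          B.act _ (B.sheaf.obj.map _ (app (toBG f) s))
        rw [app_act]
        exact congrArg _ (app_map (toBG f) _ s) }

instance : (toSheaf G).Faithful where
  map_injective {A B _ _} h := toBG_injective (hom_ext' fun {X} s =>
    ConcreteCategory.congr_hom
      (congrArg (fun φ : (toSheaf G).obj A ⟶ (toSheaf G).obj B =>
        φ.hom.app (op (⟨X⟩ : ActSite G))) h) s)

instance : (toSheaf G).Full where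
  map_surjective {A B} φ := by
    let ψ : ∀ X : AnMan K, A.sec X →+ B.sec X := fun X => (φ.hom.app (op (⟨X⟩ : ActSite G))).hom
    have hψ : ∀ {X Y : ActSite G} (a : Y ⟶ X) (s : A.sec X.base),
        ψ Y.base (A.act (ActSite.Hom.tw a) (A.sheaf.obj.map (ActSite.Hom.map a).op s)) =
          B.act (ActSite.Hom.tw a) (B.sheaf.obj.map (ActSite.Hom.map a).op (ψ X.base s)) :=
      fun a s => ConcreteCategory.congr_hom (φ.hom.naturality a.op) s
    let f : A ⟶ B :=
      ⟨homMk' (fun {X} s => ψ X s)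
        (fun {X Y} i s => by
          have := hψ ((incl G).map i) s
          change ψ Y (A.act 1 (A.sheaf.obj.map i.op s)) =
            B.act 1 (B.sheaf.obj.map i.op (ψ X s)) at this
          rwa [A.one_act, B.one_act] at this)
        (fun {X} g s => by
          have := hψ (twist (⟨X⟩ : ActSite G) g) s
          change ψ X (A.act g (A.sheaf.obj.map (𝟙 (op X)) s)) =
            B.act g (B.sheaf.obj.map (𝟙 (op X)) (ψ X s)) at this
          rw [CategoryTheory.Functor.map_id, CategoryTheory.Functor.map_id] at this
          exact this), fun {X} s t => _root_.map_add (ψ X) s t⟩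
    exact ⟨f, rfl⟩

/-- The object of `BG` attached to an abelian sheaf on the auxiliary site. -/
def ofSheafBG (P : Sheaf (ActSite.topology G) AddCommGrpCat.{u + 1}) : ClassifyingTopos G where
  sheaf := ⟨(incl G).op ⋙ P.obj ⋙ forget AddCommGrpCat.{u + 1}, by
    rw [isSheaf_iff_isSheaf_of_type, ← ActSite.isSheaf_iff (P.obj ⋙ forget AddCommGrpCat.{u + 1}),
      ← isSheaf_iff_isSheaf_of_type, ← Presheaf.isSheaf_iff_isSheaf_forget]
    exact P.property⟩
  act {X} g s := P.obj.map (twist (⟨X⟩ : ActSite G) g).op s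
  one_act s := by
    rw [twist_one, op_id, CategoryTheory.Functor.map_id]; rfl
  mul_act g h s := by
    rw [twist_mul, op_comp, CategoryTheory.Functor.map_comp]; rfl
  map_act {X Y} f g s := by
    exact (map_map' P.obj (a := twist ⟨X⟩ g) (b := (incl G).map f) (incl_comp_twist f g) s).trans
      (map_map' P.obj rfl s).symm

instance (P : Sheaf (ActSite.topology G) AddCommGrpCat.{u + 1}) (X : AnMan K) :
    AddCommGroup ((ofSheafBG P).sheaf.obj.obj (op X)) :=
  (inferInstance : AddCommGroup (P.obj.obj (op ((incl G).obj X))))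

/-- The abelian group object of `BG` attached to an abelian sheaf on the auxiliary site. -/
def ofSheaf (P : Sheaf (ActSite.topology G) AddCommGrpCat.{u + 1}) : AbObject G where
  toClassifyingTopos := ofSheafBG P
  addCommGroup _ := inferInstance
  map_add f s t := _root_.map_add (P.obj.map ((incl G).map f).op).hom s t
  act_add g s t := _root_.map_add (P.obj.map (twist _ g).op).hom s t

/-- Every abelian sheaf on the auxiliary site comes from an abelian group object of `BG`. -/
def toSheafOfSheaf (P : Sheaf (ActSite.topology G) AddCommGrpCat.{u + 1}) :
    (toSheaf G).obj (ofSheaf P) ≅ P :=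
  (fullyFaithfulSheafToPresheaf _ _).preimageIso
    (NatIso.ofComponents (fun X => AddEquiv.toAddCommGrpIso
        (X := AddCommGrpCat.of ((ofSheaf P).sec X.unop.base)) (Y := P.obj.obj X)
        (AddEquiv.refl (P.obj.obj X))) (by
      intro X Y a
      ext s
      exact map_map' P.obj (a := (incl G).map (ActSite.Hom.map a.unop))
        (b := twist Y.unop (ActSite.Hom.tw a.unop)) (eq_twist_comp a.unop).symm s))

instance : (toSheaf G).EssSurj where
  mem_essImage P := ⟨ofSheaf P, ⟨toSheafOfSheaf P⟩⟩

instance : (toSheaf G).IsEquivalence where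

instance : (toSheaf G).Additive where
  map_add := rfl

instance : Limits.HasFiniteProducts (AbObject G) :=
  ⟨fun _ => Adjunction.hasLimitsOfShape_of_equivalence (toSheaf G)⟩

noncomputable instance : Abelian (AbObject G) := abelianOfEquivalence (toSheaf G)

instance : EnoughInjectives (AbObject G) := by
  have : EssentiallySmall.{u + 1} (ActSite G) := inferInstance
  have : IsGrothendieckAbelian.{u + 1}
      (Sheaf (ActSite.topology G) AddCommGrpCat.{u + 1}) :=
    Sheaf.isGrothendieckAbelian_of_essentiallySmall _ _
  exact EnoughInjectives.of_equivalence (toSheaf G)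

end AbObject

namespace AbObject

open ClassifyingTopos

/-- The functors of sections `Γ(X, -) = Hom_BG(X, -)`, for varying objects `X` of `BG`. -/
def sections : (ClassifyingTopos G)ᵒᵖ ⥤ AbObject G ⥤ AddCommGrpCat.{u + 1} where
  obj X :=
    { obj := fun A => AddCommGrpCat.of (X.unop ⟶ A.toClassifyingTopos)
      map := fun f => AddCommGrpCat.ofHom (AddMonoidHom.mk' (fun s => s ≫ toBG f)
        (fun s t => hom_ext' fun _ => toBG_add f _ _))
      map_id := fun A => by
        ext s
        exact Category.comp_id s
      map_comp := fun f g => by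
        ext s
        exact (Category.assoc s (toBG f) (toBG g)).symm }
  map φ :=
    { app := fun A => AddCommGrpCat.ofHom (AddMonoidHom.mk' (fun s => φ.unop ≫ s)
        (fun s t => rfl))
      naturality := fun A B f => by
        ext s
        exact (Category.assoc φ.unop s (toBG f)).symm }
  map_id X := by
    ext A s
    exact Category.id_comp s
  map_comp φ ψ := by
    ext A s
    exact Category.assoc ψ.unop φ.unop s

instance (X : (ClassifyingTopos G)ᵒᵖ) : (sections.obj X : AbObject G ⥤ _).Additive where
  map_add := rfl

variable (G) in
/-- The global section functor `Γ = Hom_BG(*, -)` on abelian group objects of `BG`. -/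
def globalSections : AbObject G ⥤ AddCommGrpCat.{u + 1} := sections.obj (op (terminal G))

instance : (globalSections G).Additive := inferInstanceAs (sections.obj _).Additive

variable (G) in
/-- The cosimplicial abelian group `Γ(E_• G, A)`, functorially in `A`. -/
noncomputable def cosimplicialSections : AbObject G ⥤ CosimplicialObject AddCommGrpCat.{u + 1} :=
  ((simplicialE G).rightOp ⋙ sections).flip

variable (G) in
/-- The cohomology `H^n(Γ(E_• G, A))` of the cochain complex associated with the cosimplicial
abelian group `Γ(E_• G, A)`, functorially in `A`. -/
noncomputable def cochainCohomology (n : ℕ) : AbObject G ⥤ AddCommGrpCat.{u + 1} :=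
  cosimplicialSections G ⋙ AlgebraicTopology.alternatingCofaceMapComplex AddCommGrpCat.{u + 1} ⋙
    HomologicalComplex.homologyFunctor _ _ n

end AbObject

end ClassifyingTopos

/-!
For an injective abelian group object `I`, the complex `Γ(E_• G, I)` is exact in positive degrees:
it consists of the morphisms to `I` from the free abelian presheaves `ℤ[E_• G]`, which are
contractible over every manifold because `(g_0, …, g_n) ↦ (1, g_0, …, g_n)` is an extra degeneracy.
For every `A`, the cohomology of `Γ(E_• G, A)` in degree zero is `Γ(*, A)`, a cocycle being
determined by its value at `1`.

Moreover `A ↦ Γ(E_• G, A)` is exact. Indeed `E_p G ⟶ G^p` is a trivial `G`-torsor, so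
`Γ(E_p G, A)` is the group of sections of `A` over the manifold `G^p`. Taking sections over a
manifold is exact: every open covering has a refinement by disjoint clopen subsets, over which local
lifts glue without any compatibility condition.

Therefore the cohomology of `Γ(E_• G, A)` is a cohomological functor which vanishes on injective
objects in positive degrees, and dimension shifting identifies it with the derived functors of `Γ`.
-/

section ZeroDimensional

open Set Topology Metric Function

theorem edist_le_max_of_isUltrametricDist {Y : Type*} [PseudoMetricSpace Y] [IsUltrametricDist Y]
    (x y z : Y) : edist x z ≤ max (edist x y) (edist y z) := by
  simpa only [edist_dist, ← ENNReal.ofReal_max] using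
    ENNReal.ofReal_le_ofReal (IsUltrametricDist.dist_triangle_max x y z)

theorem infEDist_le_max_of_isUltrametricDist {Y : Type*} [PseudoMetricSpace Y]
    [IsUltrametricDist Y] (s : Set Y) (x y : Y) :
    infEDist x s ≤ max (edist x y) (infEDist y s) := by
  refine le_of_forall_gt fun r hr => ?_
  obtain ⟨z, hz, hyz⟩ := infEDist_lt_iff.1 ((le_max_right _ _).trans_lt hr)
  exact (infEDist_le_edist_of_mem hz).trans_lt ((edist_le_max_of_isUltrametricDist x y z).trans_lt
    (max_lt ((le_max_left _ _).trans_lt hr) hyz))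

theorem exists_isClopen_separating {Y : Type*} [PseudoMetricSpace Y] [IsUltrametricDist Y]
    {F H : Set Y} (hF : IsClosed F) (hH : IsClosed H) (h : Disjoint F H) :
    ∃ C : Set Y, IsClopen C ∧ F ⊆ C ∧ Disjoint C H := by
  have pos_of_le {y : Y} (hy : infEDist y H ≤ infEDist y F) : 0 < infEDist y F := by
    refine pos_of_ne_zero fun hyF => disjoint_left.1 h
      ((mem_iff_infEDist_zero_of_closed hF).2 hyF) ((mem_iff_infEDist_zero_of_closed hH).2 ?_)
    exact nonpos_iff_eq_zero.1 (hy.trans_eq hyF)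
  refine ⟨{y | infEDist y F < infEDist y H}, ⟨⟨?_⟩, ?_⟩, fun y hy => ?_, ?_⟩
  -- The complement is open since the distance to `F` is locally constant off `F`.
  · refine EMetric.isOpen_iff.2 fun y hy => ?_
    replace hy : infEDist y H ≤ infEDist y F := not_lt.1 hy
    refine ⟨infEDist y F, pos_of_le hy, fun z hz => ?_⟩
    have hyz : infEDist y F ≤ infEDist z F := by
      refine (le_max_iff.1 (infEDist_le_max_of_isUltrametricDist F y z)).resolve_left ?_
      rwa [not_le, edist_comm]
    exact not_lt.2 ((infEDist_le_max_of_isUltrametricDist H z y).trans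
      ((max_le (le_of_lt hz) hy).trans hyz))
  · exact isOpen_lt continuous_infEDist continuous_infEDist
  · by_contra hyH
    exact (pos_of_le (not_lt.1 hyH)).ne' (infEDist_zero_of_mem hy)
  · exact disjoint_left.2 fun y hy hyH =>
      not_lt_zero (hy.trans_eq (infEDist_zero_of_mem hyH))

theorem exists_isClopen_between {X Z : Type*} [TopologicalSpace X] [NormalSpace X]
    [PseudoMetricSpace Z] [IsUltrametricDist Z] {U F : Set X} (hU : IsOpen U) (hF : IsClosed F)
    (hFU : F ⊆ U) {f : X → Z} (hf : IsInducing (U.domRestrict f)) :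
    ∃ C : Set X, IsClopen C ∧ F ⊆ C ∧ C ⊆ U := by
  obtain ⟨V, hV, hFV, hVU⟩ := normal_exists_closure_subset hF hU hFU
  let := hf.comapPseudoMetricSpace
  have : IsUltrametricDist U := ⟨fun x y z =>
    IsUltrametricDist.dist_triangle_max (f x) (f y) (f z)⟩
  obtain ⟨C, hC, hFC, hCV⟩ := exists_isClopen_separating
    (F := ((↑) : U → X) ⁻¹' F) (H := ((↑) : U → X) ⁻¹' Vᶜ)
    (hF.preimage continuous_subtype_val) (hV.isClosed_compl.preimage continuous_subtype_val)
    (disjoint_left.2 fun x hx hx' => hx' (hFV hx))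
  have image_subset : ((↑) '' C : Set X) ⊆ V :=
    image_subset_iff.2 fun x hx => not_not.1 (disjoint_left.1 hCV hx)
  refine ⟨(↑) '' C, ⟨?_, hU.isOpenMap_subtype_val _ hC.isOpen⟩,
    fun x hx => ⟨⟨x, hFU hx⟩, hFC hx, rfl⟩, Subtype.coe_image_subset U C⟩
  refine isClosed_of_closure_subset fun x hx => ?_
  exact ⟨⟨x, hVU (closure_mono image_subset hx)⟩,
    hC.isClosed.closure_subset (closure_subtype.2 hx), rfl⟩

theorem exists_disjoint_isClopen_of_locallyFinite {X ι : Type*} [TopologicalSpace X]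
    {C : ι → Set X} (hC : ∀ i, IsClopen (C i)) (hf : LocallyFinite C) :
    ∃ D : ι → Set X, (∀ i, IsClopen (D i)) ∧ (∀ i, D i ⊆ C i) ∧ Pairwise (Disjoint on D) ∧
      ⋃ i, D i = ⋃ i, C i := by
  obtain ⟨_, hwf⟩ := exists_wellFoundedLT ι
  refine ⟨fun i => C i \ ⋃ j : Iio i, C j, fun i => (hC i).diff ⟨?_, ?_⟩,
    fun i => sdiff_subset, ?_, ?_⟩
  · exact (hf.comp_injective Subtype.val_injective).isClosed_iUnion fun j => (hC j).isClosed
  · exact isOpen_iUnion fun j => (hC j).isOpen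
  · exact (pairwise_disjoint_on _).2 fun i j hij => disjoint_left.2 fun z hi hj =>
      hj.2 (mem_iUnion.2 ⟨⟨i, hij⟩, hi.1⟩)
  · refine (iUnion_mono fun i => sdiff_subset).antisymm fun z hz => ?_
    have hz : {i | z ∈ C i}.Nonempty := mem_iUnion.1 hz
    refine mem_iUnion.2 ⟨_, hwf.wf.min_mem _ hz, fun hz' => ?_⟩
    obtain ⟨⟨j, hj⟩, hzj⟩ := mem_iUnion.1 hz'
    exact hwf.wf.not_lt_min {i | z ∈ C i} hzj hj

theorem exists_disjoint_isClopen_refinement_of_isInducing {X ι Z : Type*} [TopologicalSpace X]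
    [T2Space X] [ParacompactSpace X] [PseudoMetricSpace Z] [IsUltrametricDist Z] (W : ι → Set X)
    (hW : ∀ i, IsOpen (W i)) (hWc : ⋃ i, W i = univ) (f : ι → X → Z)
    (hf : ∀ i, IsInducing ((W i).domRestrict (f i))) :
    ∃ D : ι → Set X, (∀ i, IsClopen (D i)) ∧ (∀ i, D i ⊆ W i) ∧ Pairwise (Disjoint on D) ∧
      ⋃ i, D i = univ := by
  obtain ⟨V, hVo, hVc, hVf, hVW⟩ := precise_refinement W hW hWc
  obtain ⟨F, hFc, hFcl, hFV⟩ := exists_iUnion_eq_closed_subset hVo hVf.point_finite hVc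
  choose C hC hFC hCV using fun i => exists_isClopen_between (hVo i) (hFcl i) (hFV i)
    ((hf i).comp (IsEmbedding.inclusion (hVW i)).isInducing)
  obtain ⟨D, hD, hDC, hDd, hDc⟩ :=
    exists_disjoint_isClopen_of_locallyFinite hC (hVf.subset hCV)
  refine ⟨D, hD, fun i => (hDC i).trans ((hCV i).trans (hVW i)), hDd, hDc.trans ?_⟩
  exact univ_subset_iff.1 (hFc.symm.trans_subset (iUnion_mono hFC))

end ZeroDimensional

namespace AnMan

open Set Topology Function

variable {K : Type u} [NontriviallyNormedField K] [IsUltrametricDist K] [CompleteSpace K]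

theorem exists_disjoint_isClopen_refinement (X : AnMan K) (W : X → Set X)
    (hW : ∀ x, IsOpen (W x)) (hxW : ∀ x, x ∈ W x) :
    ∃ D : X → Set X, (∀ x, IsClopen (D x)) ∧ (∀ x, D x ⊆ W x) ∧ Pairwise (Disjoint on D) ∧
      ⋃ x, D x = univ := by
  let coordinates := (Module.finBasis K X.model).equivFunL
  let e (x : X) := chartAt X.model x
  obtain ⟨D, hD, hDW, hDd, hDc⟩ := exists_disjoint_isClopen_refinement_of_isInducing
    (fun x => W x ∩ (e x).source) (fun x => (hW x).inter (e x).open_source)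
    (iUnion_eq_univ_iff.2 fun x => ⟨x, hxW x, mem_chart_source _ x⟩)
    (fun x y => coordinates (e x y)) fun x =>
      coordinates.toHomeomorph.isInducing.comp ((e x).isOpenEmbedding_restrict.isInducing.comp
        (IsEmbedding.inclusion inter_subset_right).isInducing)
  exact ⟨D, hD, fun x => (hDW x).trans inter_subset_left, hDd, hDc⟩

end AnMan

section ExactFunctorToComplexes

open Limits HomologicalComplex

variable {C D : Type*} [Category* C] [Category* D] [Abelian C] [Abelian D]

instance preservesFiniteLimits_homologyFunctor_zero :
    PreservesFiniteLimits (homologyFunctor D (ComplexShape.up ℕ) 0) := by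
  refine ((Functor.preservesFiniteLimits_tfae _).out 0 3).1 fun S hS => ?_
  refine ⟨hS.homology_exact₂ 0, ?_⟩
  have := hS.mono_f
  have : Mono (cyclesMap S.f 0) := by
    have : Mono (cyclesMap S.f 0 ≫ S.X₂.iCycles 0) := by
      rw [cyclesMap_i]
      infer_instance
    exact mono_of_mono _ (S.X₂.iCycles 0)
  exact ((MorphismProperty.monomorphisms D).arrow_mk_iso_iff
    (Arrow.isoMk' _ _ (CochainComplex.isoHomologyπ₀ S.X₁) (CochainComplex.isoHomologyπ₀ S.X₂)
      (homologyπ_naturality S.f 0))).1 this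

/-- The compatibility with `f'` in `ShortComplex.LeftHomologyMapData` follows from the one with
`i`, which is a monomorphism. -/
noncomputable def leftHomologyMapDataOfComm {S₁ S₂ : ShortComplex D} {φ : S₁ ⟶ S₂}
    {h₁ : S₁.LeftHomologyData} {h₂ : S₂.LeftHomologyData} {φK : h₁.K ⟶ h₂.K} {φH : h₁.H ⟶ h₂.H}
    (commi : φK ≫ h₂.i = h₁.i ≫ φ.τ₂) (commπ : h₁.π ≫ φH = φK ≫ h₂.π) :
    ShortComplex.LeftHomologyMapData φ h₁ h₂ where
  φK := φK
  φH := φH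
  commf' := by simp [← cancel_mono h₂.i, commi, φ.comm₁₂]

/-- The short complex `Z^q ⟶ J^q ⟶ Z^{q+1}` of a cochain complex `J`. -/
noncomputable abbrev cyclesShortComplex (J : CochainComplex C ℕ) (q : ℕ) : ShortComplex C :=
  ShortComplex.mk (J.iCycles q) (J.toCycles q (q + 1)) (by
    simp [← cancel_mono (J.iCycles (q + 1))])

/-- The morphism between the short complexes `Z^q ⟶ J^q ⟶ Z^{q+1}` induced by a morphism
of complexes. -/
noncomputable def cyclesShortComplexMap {J L : CochainComplex C ℕ} (f : J ⟶ L) (q : ℕ) :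
    cyclesShortComplex J q ⟶ cyclesShortComplex L q where
  τ₁ := cyclesMap f q
  τ₂ := f.f q
  τ₃ := cyclesMap f (q + 1)
  comm₂₃ := by simp [← cancel_mono (L.iCycles (q + 1))]

theorem shortExact_cyclesShortComplex {J : CochainComplex C ℕ} {q : ℕ}
    (hJ : J.ExactAt (q + 1)) : (cyclesShortComplex J q).ShortExact where
  exact := by
    let S := ShortComplex.mk (J.iCycles q) (J.d q (q + 1)) (by simp)
    let φ : cyclesShortComplex J q ⟶ S := { τ₁ := 𝟙 _, τ₂ := 𝟙 _, τ₃ := J.iCycles (q + 1) }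
    rw [ShortComplex.exact_iff_of_epi_of_isIso_of_mono φ]
    exact S.exact_of_f_is_kernel (J.cyclesIsKernel q (q + 1) (by simp))
  mono_f := inferInstanceAs (Mono (J.iCycles q))
  epi_g := Preadditive.epi_of_isZero_cokernel' _ (J.homologyIsCokernel q (q + 1) (by simp))
    hJ.isZero_homology

variable (C) in
/-- The category of cochain complexes of injective objects which are exact in positive degrees,
that is, of injective resolutions of the kernel `Z^0` of their first differential. -/
abbrev InjectiveCocomplex : Type _ :=
  ObjectProperty.FullSubcategory fun J : CochainComplex C ℕ =>
    (∀ q, Injective (J.X q)) ∧ ∀ q, J.ExactAt (q + 1)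

namespace InjectiveCocomplex

variable (C) in
/-- The functor of cycles `J ↦ Z^q`. -/
noncomputable abbrev cycles (q : ℕ) : InjectiveCocomplex C ⥤ C :=
  ObjectProperty.ι _ ⋙ cyclesFunctor C (ComplexShape.up ℕ) q

/-- The functor `A ↦ H^n(F(A))`. -/
noncomputable abbrev cohomology (F : C ⥤ CochainComplex D ℕ) (n : ℕ) : C ⥤ D :=
  F ⋙ homologyFunctor D (.up ℕ) n

variable (F : C ⥤ CochainComplex D ℕ) [PreservesFiniteLimits F] [PreservesFiniteColimits F]

theorem shortExact_map_cyclesShortComplex (J : InjectiveCocomplex C) (q : ℕ) :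
    ((cyclesShortComplex J.obj q).map F).ShortExact :=
  (shortExact_cyclesShortComplex (J.property.2 q)).map_of_exact F

/-- The connecting homomorphism `H^n F(Z^{q+1}) ⟶ H^{n+1} F(Z^q)`. -/
noncomputable def connecting (q n : ℕ) :
    cycles C (q + 1) ⋙ cohomology F n ⟶ cycles C q ⋙ cohomology F (n + 1) where
  app J := (shortExact_map_cyclesShortComplex F J q).δ n (n + 1) rfl
  naturality _ _ f := (HomologySequence.δ_naturality
    (F.mapShortComplex.map (cyclesShortComplexMap f.hom q)) _ _ n (n + 1) rfl).symm

variable {F}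
variable (hF : ∀ (I : C) [Injective I] (n : ℕ), (F.obj I).ExactAt (n + 1))

include hF

theorem isIso_connecting_succ (q n : ℕ) : IsIso (connecting F q (n + 1)) := by
  have (J : InjectiveCocomplex C) : IsIso ((connecting F q (n + 1)).app J) := by
    have := J.property.1 q
    exact (shortExact_map_cyclesShortComplex F J q).isIso_δ (n + 1) (n + 2) rfl
      (hF (J.obj.X q) n).isZero_homology (hF (J.obj.X q) (n + 1)).isZero_homology
  exact NatIso.isIso_of_isIso_app _

theorem epi_connecting_zero_app (q : ℕ) (J : InjectiveCocomplex C) :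
    Epi ((connecting F q 0).app J) := by
  have := J.property.1 q
  exact (shortExact_map_cyclesShortComplex F J q).epi_δ 0 1 rfl (hF (J.obj.X q) 0).isZero_homology

/-- The homology of `H^0(F(J^q)) ⟶ H^0(F(J^{q+1})) ⟶ H^0(F(J^{q+2}))` is `H^1(F(Z^q))`: the cycles
are `H^0(F(Z^{q+1}))` since `H^0 F` is left exact, and the connecting homomorphism is the
projection since `H^1(F(J^q)) = 0`. -/
noncomputable def leftHomologyData (J : InjectiveCocomplex C) (q : ℕ) :
    ((((cohomology F 0).mapHomologicalComplex _).obj J.obj).sc'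
      q (q + 1) (q + 2)).LeftHomologyData :=
  let T := cohomology F 0
  let Z := KernelFork.ofι (J.obj.iCycles (q + 1)) (J.obj.iCycles_d (q + 1) (q + 2))
  let hZ : IsLimit (Z.map T) :=
    KernelFork.mapIsLimit _ (J.obj.cyclesIsKernel (q + 1) (q + 2) (by simp)) T
  have hlift : hZ.lift (KernelFork.ofι _
      (((T.mapHomologicalComplex _).obj J.obj).sc' q (q + 1) (q + 2)).zero) =
      T.map (J.obj.toCycles q (q + 1)) :=
    Fork.IsLimit.hom_ext hZ ((Fork.IsLimit.lift_ι hZ).trans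
      ((T.congr_map (J.obj.toCycles_i q (q + 1)).symm).trans (T.map_comp _ _)))
  let S := ShortComplex.mk (T.map (J.obj.toCycles q (q + 1))) ((connecting F q 0).app J)
    ((shortExact_map_cyclesShortComplex F J q).comp_δ 0 1 rfl)
  have hS : S.Exact := (shortExact_map_cyclesShortComplex F J q).homology_exact₃ 0 1 rfl
  have : Epi S.g := epi_connecting_zero_app hF q J
  { K := T.obj (J.obj.cycles (q + 1))
    H := (cohomology F 1).obj (J.obj.cycles q)
    i := T.map (J.obj.iCycles (q + 1))
    π := (connecting F q 0).app J
    wi := (Z.map T).condition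
    hi := hZ
    wπ := (congrArg (· ≫ S.g) hlift).trans S.zero
    hπ := CokernelCofork.isColimitOfIsColimitOfIff' hS.gIsCokernel _ fun _ φ =>
      iff_of_eq (congrArg (· ≫ φ = 0) hlift.symm) }

/-- The morphism induced by a morphism of complexes on the homology data `H^1(F(Z^q))`. -/
noncomputable def leftHomologyMapData {J L : InjectiveCocomplex C} (f : J ⟶ L) (q : ℕ) :
    ShortComplex.LeftHomologyMapData
      ((shortComplexFunctor' D _ q (q + 1) (q + 2)).map
        (((cohomology F 0).mapHomologicalComplex _).map f.hom))
      (leftHomologyData hF J q) (leftHomologyData hF L q) :=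
  leftHomologyMapDataOfComm
    (((cohomology F 0).map_comp (cyclesMap f.hom (q + 1)) (L.obj.iCycles (q + 1))).symm.trans
      (((cohomology F 0).congr_map (cyclesMap_i f.hom (q + 1))).trans
        ((cohomology F 0).map_comp _ _)))
    ((connecting F q 0).naturality f).symm

/-- The functors `J ↦ H^1(F(Z^q))` and `J ↦ H^{q+1}(H^0(F(J)))` are isomorphic. -/
noncomputable def cohomologyOneCyclesIso (q : ℕ) :
    cycles C q ⋙ cohomology F 1 ≅
      ObjectProperty.ι _ ⋙ (cohomology F 0).mapHomologicalComplex (.up ℕ) ⋙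
        homologyFunctor D _ (q + 1) :=
  (NatIso.ofComponents (F := ObjectProperty.ι _ ⋙ (cohomology F 0).mapHomologicalComplex _ ⋙
      shortComplexFunctor' D (.up ℕ) q (q + 1) (q + 2) ⋙ ShortComplex.homologyFunctor D)
      (G := cycles C q ⋙ cohomology F 1)
      (fun J => (leftHomologyData hF J q).homologyIso)
      (fun f => (leftHomologyMapData hF f q).homologyMap_comm)).symm ≪≫
    Functor.isoWhiskerLeft (ObjectProperty.ι _ ⋙ (cohomology F 0).mapHomologicalComplex (.up ℕ))
      (homologyFunctorIso' D (.up ℕ) q (q + 1) (q + 2) (by simp) (by simp)).symm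

theorem nonempty_cyclesCohomologyIso (n q : ℕ) : Nonempty
    (cycles C q ⋙ cohomology F (n + 1) ≅
      ObjectProperty.ι _ ⋙ (cohomology F 0).mapHomologicalComplex (.up ℕ) ⋙
        homologyFunctor D _ (q + n + 1)) := by
  induction n generalizing q with
  | zero => exact ⟨cohomologyOneCyclesIso hF q⟩
  | succ n ih =>
    obtain ⟨e⟩ := ih (q + 1)
    rw [show q + 1 + n = q + (n + 1) by omega] at e
    have := isIso_connecting_succ hF q n
    exact ⟨(asIso (connecting F q (n + 1))).symm ≪≫ e⟩

end InjectiveCocomplex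

open InjectiveCocomplex

/-- The isomorphism of an object with the cycles in degree `0` of an injective resolution. -/
noncomputable def resolutionCyclesIso {A : C} (I : InjectiveResolution A) :
    A ≅ I.cocomplex.cycles 0 :=
  I.isLimitKernelFork.conePointUniqueUpToIso (I.cocomplex.cyclesIsKernel 0 1 (by simp))

theorem resolutionCyclesIso_hom_iCycles {A : C} (I : InjectiveResolution A) :
    (resolutionCyclesIso I).hom ≫ I.cocomplex.iCycles 0 = I.ι.f 0 :=
  IsLimit.conePointUniqueUpToIso_hom_comp _ _ WalkingParallelPair.zero

theorem resolutionCyclesIso_hom_naturality {A B : C} (f : A ⟶ B) (I : InjectiveResolution A)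
    (J : InjectiveResolution B) :
    f ≫ (resolutionCyclesIso J).hom =
      (resolutionCyclesIso I).hom ≫ cyclesMap (InjectiveResolution.desc f J I) 0 := by
  rw [← cancel_mono (J.cocomplex.iCycles 0), Category.assoc, Category.assoc, cyclesMap_i,
    resolutionCyclesIso_hom_iCycles, ← Category.assoc, resolutionCyclesIso_hom_iCycles]
  exact (InjectiveResolution.desc_commutes_zero f J I).symm

variable [EnoughInjectives C]

/-- A choice of an injective resolution of an object, as an object of `InjectiveCocomplex C`. -/
noncomputable abbrev resolution (A : C) : InjectiveCocomplex C :=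
  ⟨(injectiveResolution A).cocomplex,
    (injectiveResolution A).injective, (injectiveResolution A).cocomplex_exactAt_succ⟩

theorem nonempty_rightDerived_iso (F : C ⥤ CochainComplex D ℕ) [F.Additive]
    [PreservesFiniteLimits F] [PreservesFiniteColimits F]
    (hF : ∀ (I : C) [Injective I] (n : ℕ), (F.obj I).ExactAt (n + 1)) (n : ℕ) :
    Nonempty ((F ⋙ homologyFunctor D (.up ℕ) 0).rightDerived n ≅
      F ⋙ homologyFunctor D (.up ℕ) n) := by
  cases n with
  | zero => exact ⟨Functor.rightDerivedZeroIsoSelf _⟩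
  | succ n =>
    obtain ⟨e⟩ := nonempty_cyclesCohomologyIso hF n 0
    rw [zero_add] at e
    let T (n : ℕ) : C ⥤ D := cohomology F n
    let I (A : C) : InjectiveResolution A := injectiveResolution A
    refine ⟨(NatIso.ofComponents (fun A => (T (n + 1)).mapIso (resolutionCyclesIso (I A)) ≪≫
      e.app (resolution A) ≪≫ ((I A).isoRightDerivedObj (T 0) (n + 1)).symm)
      fun {A B} f => ?_).symm⟩
    let φ : (I A).cocomplex ⟶ (I B).cocomplex := InjectiveResolution.desc f (I B) (I A)
    have cycles_comm : CommSq ((T (n + 1)).map (resolutionCyclesIso (I A)).hom)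
        ((T (n + 1)).map f) ((T (n + 1)).map (cyclesMap φ 0))
        ((T (n + 1)).map (resolutionCyclesIso (I B)).hom) :=
      (CommSq.mk (resolutionCyclesIso_hom_naturality f (I A) (I B)).symm).map (T (n + 1))
    have e_comm := CommSq.mk
      (e.hom.naturality (X := resolution A) (Y := resolution B) (ObjectProperty.homMk φ)).symm
    have derived_comm := CommSq.mk
      (InjectiveResolution.isoRightDerivedObj_inv_naturality f (I A) (I B) φ
        (InjectiveResolution.desc_commutes_zero f _ _) (T 0) (n + 1))
    exact (cycles_comm.horiz_comp (e_comm.horiz_comp derived_comm)).w.symm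

end ExactFunctorToComplexes

section FunctorCategory

open Limits

variable {J A : Type*} [Category* J] [Category* A] [Abelian A]

theorem exactAt_of_evaluation {ι : Type*} {c : ComplexShape ι} {L : HomologicalComplex (J ⥤ A) c}
    {i : ι} (hL : ∀ X, ((((evaluation J A).obj X).mapHomologicalComplex c).obj L).ExactAt i) :
    L.ExactAt i := by
  rw [HomologicalComplex.exactAt_iff_isZero_homology, Functor.isZero_iff]
  exact fun X => (hL X).isZero_homology.of_iso
    ((L.sc i).mapHomologyIso ((evaluation J A).obj X)).symm

theorem exactAt_alternatingFaceMapComplex {X : SimplicialObject.Augmented A}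
    (ed : X.ExtraDegeneracy) (n : ℕ) :
    ((AlgebraicTopology.alternatingFaceMapComplex A).obj X.left).ExactAt (n + 1) :=
  have := ed.homotopyEquiv.quasiIso_hom
  (exactAt_iff_of_quasiIsoAt ed.homotopyEquiv.hom (n + 1)).2
    (ChainComplex.exactAt_succ_single_obj _ n)

end FunctorCategory

namespace ClassifyingTopos

open ActSite Limits SimplicialObject

variable {K : Type u} [NontriviallyNormedField K]
variable {G : AnMan K} [Group G] [LieGroup 𝓘(K, G.model) ω G]

variable (G) in
/-- The presheaf of sets on the auxiliary site attached to an object of `BG`. -/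
def presheaf : ClassifyingTopos G ⥤ (ActSite G)ᵒᵖ ⥤ Type (u + 1) where
  obj B :=
    { obj X := B.sheaf.obj.obj (op X.unop.base)
      map a := TypeCat.ofHom fun s =>
        B.act (ActSite.Hom.tw a.unop) (B.sheaf.obj.map (ActSite.Hom.map a.unop).op s)
      map_id X := by
        ext s
        change B.act 1 (B.sheaf.obj.map (𝟙 _) s) = s
        rw [B.one_act, CategoryTheory.Functor.map_id]
        rfl
      map_comp a b := by
        ext s
        change B.act (_ * _)
          (B.sheaf.obj.map ((ActSite.Hom.map a.unop).op ≫ (ActSite.Hom.map b.unop).op) s) =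
            B.act _ (B.sheaf.obj.map _ (B.act _ (B.sheaf.obj.map _ s)))
        rw [B.mul_act, B.map_act, CategoryTheory.Functor.map_comp]
        rfl }
  map f :=
    { app X := TypeCat.ofHom fun s => app f s
      naturality X Y a := by
        ext s
        exact (app_act f _ _).trans (congrArg _ (app_map f _ s)) }

variable (G) in
/-- Morphisms of `BG` are the morphisms between the associated presheaves on the auxiliary site. -/
def fullyFaithfulPresheaf : (presheaf G).FullyFaithful where
  preimage {B B'} φ := homMk' (fun {X} s => φ.app (op ⟨X⟩) s)
    (fun {X Y} i s => by
      have := NatTrans.naturality_apply φ ((incl G).map i).op s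
      change φ.app (op ⟨Y⟩) (B.act 1 (B.sheaf.obj.map i.op s)) =
        B'.act 1 (B'.sheaf.obj.map i.op (φ.app (op ⟨X⟩) s)) at this
      rwa [B.one_act, B'.one_act] at this)
    (fun {X} g s => by
      have := NatTrans.naturality_apply φ (twist (⟨X⟩ : ActSite G) g).op s
      change φ.app (op ⟨X⟩) (B.act g (B.sheaf.obj.map (𝟙 (op X)) s)) =
        B'.act g (B'.sheaf.obj.map (𝟙 (op X)) (φ.app (op ⟨X⟩) s)) at this
      rw [CategoryTheory.Functor.map_id, CategoryTheory.Functor.map_id] at this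
      exact this)

variable (G) in
/-- The simplicial object `y(E_• G)` of `BG`, augmented to the terminal object. -/
noncomputable def augmentedE : SimplicialObject.Augmented (ClassifyingTopos G) where
  left := simplicialE G
  right := terminal G
  hom :=
    { app _ := isTerminalTerminal.from _
      naturality _ _ _ := isTerminalTerminal.hom_ext _ _ }

variable (G) in
/-- The object `y(E_n G)` of `BG`. -/
noncomputable abbrev EPower (n : ℕ) : ClassifyingTopos G := EObj (op (SimplexCategory.mk n))

variable (G) in
/-- The section `1` of `y(E_0 G)`. -/
noncomputable def one (X : AnMan K) : (EPower G 0).sheaf.obj.obj (op X) :=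
  ULift.up (powerLift fun _ => 1)

/-- The section `(1, g_0, …, g_n)` of `y(E_{n+1} G)` attached to `(g_0, …, g_n)`. -/
noncomputable def consOne {n : ℕ} {X : AnMan K} (x : (EPower G n).sheaf.obj.obj (op X)) :
    (EPower G (n + 1)).sheaf.obj.obj (op X) :=
  ULift.up (powerLift (Fin.cons (α := fun _ => X ⟶ G) 1
    (fun i : Fin (n + 1) => x.down ≫ powerProj i)))

/-- The contraction `(g_0, …, g_n) ↦ (1, g_0, …, g_n)` of the sections of `y(E_• G)` over an
object of the auxiliary site. It is not equivariant, hence not functorial in that object. -/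
noncomputable def extraDegeneracy (X : (ActSite G)ᵒᵖ) :
    Augmented.ExtraDegeneracy (((Augmented.whiskering _ _).obj
      (presheaf G ⋙ (evaluation _ _).obj X)).obj (augmentedE G)) where
  s' := TypeCat.ofHom fun _ => one G X.unop.base
  s n := TypeCat.ofHom consOne
  s'_comp_ε := rfl
  s₀_comp_δ₁ := by
    ext x
    refine ULift.ext _ _ (power_ext fun i => ?_)
    obtain rfl : i = 0 := Subsingleton.elim (α := Fin 1) _ _
    rfl
  s_comp_δ₀ n := by
    ext x
    exact ULift.ext _ _ (power_ext fun _ => rfl)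
  s_comp_δ n j := by
    ext x
    refine ULift.ext _ _ (power_ext fun i => ?_)
    change Fin.cons (α := fun _ => X.unop.base ⟶ G) 1 (fun i : Fin (n + 2) => x.down ≫ powerProj i)
      (j.succ.succAbove i) = Fin.cons (α := fun _ => X.unop.base ⟶ G) 1
        (fun i : Fin (n + 1) => x.down ≫ powerProj (j.succAbove i)) i
    induction i using Fin.cases with
    | zero => rw [Fin.succ_succAbove_zero]; rfl
    | succ i => rw [Fin.succ_succAbove_succ]; rfl
  s_comp_σ n j := by
    ext x
    refine ULift.ext _ _ (power_ext fun i => ?_)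
    change Fin.cons (α := fun _ => X.unop.base ⟶ G) 1 (fun i : Fin (n + 1) => x.down ≫ powerProj i)
      (j.succ.predAbove i) = Fin.cons (α := fun _ => X.unop.base ⟶ G) 1
        (fun i : Fin (n + 2) => x.down ≫ powerProj (j.predAbove i)) i
    induction i using Fin.cases with
    | zero => rfl
    | succ i => rw [Fin.succ_predAbove_succ]; rfl

end ClassifyingTopos

namespace AbObject

open ClassifyingTopos ActSite Limits AlgebraicTopology

variable {K : Type u} [NontriviallyNormedField K]
variable {G : AnMan K} [Group G] [LieGroup 𝓘(K, G.model) ω G]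

variable (G) in
/-- The presheaf of free abelian groups on the sections of an object of `BG`. -/
noncomputable def freePresheaf : ClassifyingTopos G ⥤ (ActSite G)ᵒᵖ ⥤ AddCommGrpCat.{u + 1} :=
  presheaf G ⋙ (Functor.whiskeringRight _ _ _).obj AddCommGrpCat.free

/-- The adjunction between abelian group objects and objects of `BG`, before sheafification. -/
noncomputable def freePresheafHomEquiv (B : ClassifyingTopos G) (A : AbObject G) :
    ((freePresheaf G).obj B ⟶ A.toPresheaf) ≃+ (B ⟶ A.toClassifyingTopos) where
  toEquiv := ((AddCommGrpCat.adj.whiskerRight _).homEquiv _ _).trans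
    (fullyFaithfulPresheaf G).homEquiv.symm
  map_add' _ _ := rfl

theorem freePresheafHomEquiv_app {B : ClassifyingTopos G} {A : AbObject G}
    (φ : (freePresheaf G).obj B ⟶ A.toPresheaf) {X : AnMan K} (s : B.sheaf.obj.obj (op X)) :
    app (freePresheafHomEquiv B A φ) s = φ.app (op ⟨X⟩) (FreeAbelianGroup.of s) := rfl

theorem freePresheafHomEquiv_map_comp {B B' : ClassifyingTopos G} {A : AbObject G} (f : B ⟶ B')
    (φ : (freePresheaf G).obj B' ⟶ A.toPresheaf) :
    freePresheafHomEquiv B A ((freePresheaf G).map f ≫ φ) = f ≫ freePresheafHomEquiv B' A φ :=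
  hom_ext' fun {X} s => by
    rw [comp_app, freePresheafHomEquiv_app, freePresheafHomEquiv_app]
    exact congrArg (φ.app (op ⟨X⟩)) (FreeAbelianGroup.map_of_apply s)

variable (G) in
/-- The chain complex `ℤ[E_• G]` of presheaves on the auxiliary site. -/
noncomputable def freeComplex : ChainComplex ((ActSite G)ᵒᵖ ⥤ AddCommGrpCat.{u + 1}) ℕ :=
  (alternatingFaceMapComplex _).obj (simplicialE G ⋙ freePresheaf G)

theorem exactAt_freeComplex (n : ℕ) : (freeComplex G).ExactAt (n + 1) :=
  exactAt_of_evaluation fun X =>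
    (Functor.congr_obj (map_alternatingFaceMapComplex ((evaluation _ _).obj X))
      (simplicialE G ⋙ freePresheaf G)).symm ▸
        exactAt_alternatingFaceMapComplex ((extraDegeneracy X).map AddCommGrpCat.free) n

end AbObject

namespace AnMan

open Set Topology Function

variable {K : Type u} [NontriviallyNormedField K]

theorem existsUnique_glue_of_disjoint {P : (AnMan K)ᵒᵖ ⥤ Type (u + 1)}
    (hP : Presieve.IsSheaf (topology K) P) {X : AnMan K} {ι : Type*} (Y : ι → AnMan K)
    (j : ∀ i, Y i ⟶ X) (hj : ∀ i, IsOpenImmersion (j i))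
    (hd : Pairwise (Disjoint on fun i => range (j i))) (hc : ⋃ i, range (j i) = univ)
    (t : ∀ i, P.obj (op (Y i))) :
    ∃! s : P.obj (op X), ∀ i, P.map (j i).op s = t i := by
  have isSheafFor : Presieve.IsSheafFor P (Presieve.ofArrows Y j) := by
    rw [Presieve.isSheafFor_iff_generate]
    refine hP _ fun x => ?_
    obtain ⟨i, hi⟩ := iUnion_eq_univ_iff.1 hc x
    exact ⟨Y i, j i, Sieve.le_generate _ _ _ (Presieve.ofArrows.mk i), hj i, hi⟩
  refine (Presieve.isSheafFor_arrows_iff _ _).1 isSheafFor t fun i i' Z g g' h => ?_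
  obtain rfl | hne := eq_or_ne i i'
  · rw [hom_ext fun z => (hj i).1 (DFunLike.congr_fun h z)]
  -- A manifold mapping to two disjoint pieces is empty, so it is covered by the empty sieve.
  · have isEmpty (z : Z) : False :=
      disjoint_left.1 (hd hne) ⟨g z, rfl⟩ ⟨g' z, (DFunLike.congr_fun h z).symm⟩
    exact (hP ⊥ fun z => (isEmpty z).elim).isSeparatedFor.ext fun _ _ hf => hf.elim

variable [IsUltrametricDist K] [CompleteSpace K]

theorem exists_disjoint_openImmersions {X : AnMan K} {S : Sieve X} (hS : S ∈ topology K X) :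
    ∃ (Y : X → AnMan K) (j : ∀ x, Y x ⟶ X), (∀ x, S (j x)) ∧ (∀ x, IsOpenImmersion (j x)) ∧
      Pairwise (Disjoint on fun x => range (j x)) ∧ ⋃ x, range (j x) = univ := by
  choose Y f hSf hf hx using hS
  obtain ⟨D, hD, hDf, hd, hc⟩ := exists_disjoint_isClopen_refinement X (fun x => range (f x))
    (fun x => (hf x).2.isOpen_range) hx
  let V (x : X) : TopologicalSpace.Opens X := ⟨D x, (hD x).isOpen⟩
  have (x : X) : ParacompactSpace (V x) :=
    (hD x).isClosed.isClosedEmbedding_subtypeVal.paracompactSpace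
  have range_eq : (fun x => range (X.opensVal (V x))) = D := funext fun x => Subtype.range_val
  refine ⟨fun x => X.opens (V x), fun x => X.opensVal (V x), fun x => ?_,
    fun x => isOpenImmersion_opensVal X (V x), range_eq ▸ hd, range_eq ▸ hc⟩
  obtain ⟨h, hh⟩ := (hf x).lift (X.opensVal (V x)) fun z =>
    hDf x ((congrFun range_eq x).subset (mem_range_self z))
  have mem := S.downward_closed (hSf x) h
  rwa [hh] at mem

end AnMan

namespace AbObject

open ClassifyingTopos ActSite Limits AlgebraicTopology

variable {K : Type u} [NontriviallyNormedField K]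
variable {G : AnMan K} [Group G] [LieGroup 𝓘(K, G.model) ω G]

section SectionsOverManifolds

variable (G) in
/-- The functor of sections over a manifold. -/
noncomputable def secFunctor (X : AnMan K) : AbObject G ⥤ AddCommGrpCat.{u + 1} :=
  toSheaf G ⋙ sheafToPresheaf _ _ ⋙ (evaluation _ _).obj (op ⟨X⟩)

instance (X : AnMan K) : (secFunctor G X).Additive where
  map_add := rfl

instance (X : AnMan K) : PreservesFiniteLimits (secFunctor G X) := by
  unfold secFunctor
  infer_instance

variable [IsUltrametricDist K] [CompleteSpace K]

theorem secHom_surjective_of_epi (X : AnMan K) {A B : AbObject G} (g : A ⟶ B) [Epi g] :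
    Function.Surjective (secHom g X) := by
  intro s
  have : Sheaf.IsLocallySurjective ((toSheaf G).map g) := by
    rw [Sheaf.isLocallySurjective_iff_epi']
    infer_instance
  obtain ⟨Y, j, hj, hji, hd, hc⟩ := exists_disjoint_openImmersions
    (Presheaf.imageSieve_mem (ActSite.topology G) ((toSheaf G).map g).hom
      (U := op (⟨X⟩ : ActSite G)) s)
  have local_lift (x : X) : ∃ t : A.sec (Y x), app (toBG g) t = B.sheaf.obj.map (j x).op s :=
    (hj x).imp fun t ht => ht.trans (B.one_act _)
  choose t ht using local_lift
  obtain ⟨a, ha, -⟩ := existsUnique_glue_of_disjoint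
    ((isSheaf_iff_isSheaf_of_type _ _).1 A.sheaf.property) Y j hji hd hc t
  refine ⟨a, (existsUnique_glue_of_disjoint ((isSheaf_iff_isSheaf_of_type _ _).1 B.sheaf.property)
    Y j hji hd hc fun x => B.sheaf.obj.map (j x).op s).unique (fun x => ?_) fun _ => rfl⟩
  change B.sheaf.obj.map (j x).op (app (toBG g) a) = _
  rw [← app_map, ha, ht]

instance (X : AnMan K) : PreservesFiniteColimits (secFunctor G X) := by
  refine (secFunctor G X).preservesFiniteColimits_iff_forall_exact_map_and_epi.2 fun S hS => ?_
  have := hS.epi_g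
  exact ⟨((secFunctor G X).preservesFiniteLimits_iff_forall_exact_map_and_mono.1
    inferInstance S hS).1,
    (AddCommGrpCat.epi_iff_surjective _).2 (secHom_surjective_of_epi X S.g)⟩

end SectionsOverManifolds

section Torsor

variable {p : SimplexCategoryᵒᵖ}

variable (G p) in
/-- The section `(1, g_1, …, g_p)` of `y(E_p G)` over `G ^ p`. -/
noncomputable def universalSection :
    (EObj (G := G) p).sheaf.obj.obj (op (power G (Fin p.unop.len))) :=
  ULift.up (powerLift (Fin.cons (α := fun _ => power G (Fin p.unop.len) ⟶ G) 1 powerProj))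

/-- The component `g_i` of a section `(g_0, …, g_p)` of `y(E_p G)`. -/
noncomputable def component {X : AnMan K} (x : (EObj (G := G) p).sheaf.obj.obj (op X))
    (i : Fin (p.unop.len + 1)) : X ⟶ G :=
  x.down ≫ powerProj i

/-- The projection `(g_0, …, g_p) ↦ (g_0⁻¹ g_1, …, g_0⁻¹ g_p)` of the torsor `E_p G` onto `G ^ p`,
on sections. -/
noncomputable def quotientMap {X : AnMan K} (x : (EObj (G := G) p).sheaf.obj.obj (op X)) :
    X ⟶ power G (Fin p.unop.len) :=
  powerLift fun i => (component x 0)⁻¹ * component x i.succ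

theorem quotientMap_act {X : AnMan K} (g : X ⟶ G) (x : (EObj (G := G) p).sheaf.obj.obj (op X)) :
    quotientMap ((EObj p).act g x) = quotientMap x :=
  power_ext fun i => by
    change (g * component x 0)⁻¹ * (g * component x i.succ) = _
    rw [mul_inv_rev, mul_assoc, inv_mul_cancel_left]
    rfl

theorem quotientMap_map {X Y : AnMan K} (f : Y ⟶ X) (x : (EObj (G := G) p).sheaf.obj.obj (op X)) :
    quotientMap ((EObj p).sheaf.obj.map f.op x) = f ≫ quotientMap x :=
  power_ext fun _ => rfl

theorem quotientMap_universalSection :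
    quotientMap (universalSection G p) = 𝟙 (power G (Fin p.unop.len)) :=
  power_ext fun i => by
    change (1 : power G (Fin p.unop.len) ⟶ G)⁻¹ * powerProj i = powerProj i
    rw [inv_one, one_mul]

theorem act_map_universalSection {X : AnMan K} (x : (EObj (G := G) p).sheaf.obj.obj (op X)) :
    (EObj p).act (component x 0) ((EObj p).sheaf.obj.map (quotientMap x).op
      (universalSection G p)) = x := by
  refine ULift.ext _ _ (power_ext fun i => ?_)
  change component x 0 * (quotientMap x ≫
    Fin.cons (α := fun _ => power G (Fin p.unop.len) ⟶ G) 1 powerProj i) = component x i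
  induction i using Fin.cases with
  | zero => exact mul_one (component x 0)
  | succ i => exact mul_inv_cancel_left (component x 0) (component x i.succ)

/-- The identification of `Γ(y(E_p G), A)` with `A(G ^ p)`: the trivial torsor `E_p G` over `G ^ p`
is generated by its universal section. -/
noncomputable def sectionsEquiv (p : SimplexCategoryᵒᵖ) (A : AbObject G) :
    (EObj (G := G) p ⟶ A.toClassifyingTopos) ≃+ A.sec (power G (Fin p.unop.len)) where
  toFun ψ := app ψ (universalSection G p)
  invFun s := homMk' (fun {X} x => A.act (component x 0) (A.sheaf.obj.map (quotientMap x).op s))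
    (fun {X Y} f x => by
      rw [A.map_act, quotientMap_map, op_comp, CategoryTheory.Functor.map_comp]
      rfl)
    (fun {X} g x => by
      rw [quotientMap_act, ← A.mul_act]
      rfl)
  left_inv ψ := hom_ext' fun {X} x => by
    rw [homMk'_app, ← app_map, ← app_act, act_map_universalSection]
  right_inv s := by
    change A.act 1 (A.sheaf.obj.map (quotientMap (universalSection G p)).op s) = s
    rw [quotientMap_universalSection, op_id, CategoryTheory.Functor.map_id, A.one_act]
    rfl
  map_add' _ _ := rfl

/-- The identification of `Γ(y(E_p G), A)` with `A(G ^ p)`, naturally in `A`. -/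
noncomputable def sectionsIso (p : SimplexCategoryᵒᵖ) :
    sections.obj (op (EObj (G := G) p)) ≅ secFunctor G (power G (Fin p.unop.len)) :=
  NatIso.ofComponents (fun A => AddEquiv.toAddCommGrpIso
    (X := AddCommGrpCat.of (EObj (G := G) p ⟶ A.toClassifyingTopos))
    (Y := AddCommGrpCat.of (A.sec (power G (Fin p.unop.len)))) (sectionsEquiv p A))
    fun _ => rfl

end Torsor

section Cochains

variable (G) in
/-- The cochain complex of `Γ(E_• G, A)`, functorially in `A`. -/
noncomputable def cochains : AbObject G ⥤ CochainComplex AddCommGrpCat.{u + 1} ℕ :=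
  cosimplicialSections G ⋙ AlgebraicTopology.alternatingCofaceMapComplex AddCommGrpCat.{u + 1}

instance : (cochains G).Additive where
  map_add := by
    intro A B f g
    ext n x
    rfl

variable [IsUltrametricDist K] [CompleteSpace K]

theorem shortExact_map_cochains (S : ShortComplex (AbObject G)) (hS : S.ShortExact) :
    (S.map (cochains G)).ShortExact := by
  refine HomologicalComplex.shortExact_of_degreewise_shortExact _ fun p => ?_
  change (S.map (sections.obj (op (EObj (op (SimplexCategory.mk p)))))).ShortExact
  exact (ShortComplex.shortExact_iff_of_iso (S.mapNatIso (sectionsIso _))).2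
    (hS.map_of_exact (secFunctor G _))

theorem preservesFiniteLimits_and_colimits_cochains :
    PreservesFiniteLimits (cochains G) ∧ PreservesFiniteColimits (cochains G) :=
  ((cochains G).exact_tfae.out 0 3).1 shortExact_map_cochains

instance : PreservesFiniteLimits (cochains G) :=
  preservesFiniteLimits_and_colimits_cochains.1

instance : PreservesFiniteColimits (cochains G) :=
  preservesFiniteLimits_and_colimits_cochains.2

end Cochains

section Acyclicity

/-- The face maps of `y(E_• G)`. -/
noncomputable def face {n : ℕ} (i : Fin (n + 2)) : EPower G (n + 1) ⟶ EPower G n :=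
  (simplicialE G).δ i

/-- The differential of the complex `Γ(E_• G, A)`, as a map between groups of morphisms. -/
noncomputable def cochainsD (A : AbObject G) (n : ℕ) :
    (EPower G n ⟶ A.toClassifyingTopos) →+ (EPower G (n + 1) ⟶ A.toClassifyingTopos) :=
  (((cochains G).obj A).d n (n + 1)).hom

theorem cochainsD_apply (A : AbObject G) (n : ℕ) (ψ : EPower G n ⟶ A.toClassifyingTopos) :
    cochainsD A n ψ = ∑ i : Fin (n + 2), (-1 : ℤ) ^ (i : ℕ) • (face i ≫ ψ) := by
  let evalAt : ((sections.obj (op (EPower G n))).obj A ⟶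
      (sections.obj (op (EPower G (n + 1)))).obj A) →+
      (EPower G (n + 1) ⟶ A.toClassifyingTopos) :=
    AddMonoidHom.mk' (fun φ => φ ψ) fun _ _ => rfl
  have d_eq : ((cochains G).obj A).d n (n + 1) = ∑ i : Fin (n + 2), (-1 : ℤ) ^ (i : ℕ) •
      (sections.map (face (G := G) i).op).app A :=
    CochainComplex.of_d (fun n => ((cosimplicialSections G).obj A).obj (.mk n))
      (AlternatingCofaceMapComplex.objD ((cosimplicialSections G).obj A)) n
  refine (congrArg evalAt d_eq).trans ((map_sum evalAt _ _).trans ?_)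
  exact Finset.sum_congr rfl fun i _ => map_zsmul evalAt _ _

/-- The identification of the complex of morphisms from `ℤ[E_• G]` to `A` with `Γ(E_• G, A)`. -/
noncomputable def freeComplexHomEquiv (A : AbObject G) (n : ℕ) :
    ((freeComplex G).X n ⟶ A.toPresheaf) ≃+ (EPower G n ⟶ A.toClassifyingTopos) :=
  freePresheafHomEquiv (EPower G n) A

theorem freeComplexHomEquiv_d_comp (A : AbObject G) (n : ℕ)
    (φ : (freeComplex G).X n ⟶ A.toPresheaf) :
    freeComplexHomEquiv A (n + 1) ((freeComplex G).d (n + 1) n ≫ φ) =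
      cochainsD A n (freeComplexHomEquiv A n φ) := by
  let precomp : ((freeComplex G).X (n + 1) ⟶ (freeComplex G).X n) →+
      (EPower G (n + 1) ⟶ A.toClassifyingTopos) :=
    (freeComplexHomEquiv A (n + 1)).toAddMonoidHom.comp (Preadditive.rightComp _ φ)
  have precomp_face (i : Fin (n + 2)) :
      precomp ((freePresheaf G).map (face i)) = face i ≫ freeComplexHomEquiv A n φ :=
    freePresheafHomEquiv_map_comp (face i) φ
  rw [cochainsD_apply]
  refine (congrArg precomp (alternatingFaceMapComplex_obj_d _ n)).trans
    ((map_sum precomp _ _).trans (Finset.sum_congr rfl fun i _ => ?_))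
  exact (map_zsmul precomp _ _).trans (congrArg _ (precomp_face i))

instance (I : AbObject G) [Injective I] : Injective I.toPresheaf := by
  have : Injective ((toSheaf G).obj I) :=
    Injective.injective_of_adjoint (toSheaf G).asEquivalence.symm.toAdjunction I
  have : EssentiallySmall.{u + 1} (ActSite G) := inferInstance
  exact Injective.injective_of_adjoint
    (sheafificationAdjunction (ActSite.topology G) AddCommGrpCat.{u + 1}) ((toSheaf G).obj I)

theorem exactAt_cochains_of_injective (I : AbObject G) [Injective I] (n : ℕ) :
    ((cochains G).obj I).ExactAt (n + 1) := by
  rw [HomologicalComplex.exactAt_iff' _ n (n + 1) (n + 2) (by simp) (by simp),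
    ShortComplex.ab_exact_iff]
  intro (ψ : EPower G (n + 1) ⟶ I.toClassifyingTopos) (hψ : cochainsD I (n + 1) ψ = 0)
  let φ := (freeComplexHomEquiv I (n + 1)).symm ψ
  have hφ : (freeComplex G).d (n + 2) (n + 1) ≫ φ = 0 := by
    apply (freeComplexHomEquiv I (n + 2)).injective
    rw [freeComplexHomEquiv_d_comp, map_zero, AddEquiv.apply_symm_apply, hψ]
  have hex := ((freeComplex G).exactAt_iff' (n + 2) (n + 1) n (by simp) (by simp)).1
    (exactAt_freeComplex n)
  let χ : (freeComplex G).X n ⟶ I.toPresheaf := hex.descToInjective φ hφ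
  have hχ : (freeComplex G).d (n + 1) n ≫ χ = φ := hex.comp_descToInjective φ hφ
  exact ⟨freeComplexHomEquiv I n χ, (freeComplexHomEquiv_d_comp I n χ).symm.trans
    ((congrArg _ hχ).trans ((freeComplexHomEquiv I (n + 1)).apply_symm_apply ψ))⟩

end Acyclicity

section DegreeZero

variable (G) in
/-- The morphism `y(E_0 G) ⟶ *`. -/
noncomputable def augmentation : EPower G 0 ⟶ terminal G := isTerminalTerminal.from _

theorem app_face_zero_consOne {X : AnMan K} (x : (EPower G 0).sheaf.obj.obj (op X)) :
    app (face 0) (consOne x) = x :=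
  ULift.ext _ _ (power_ext fun _ => rfl)

theorem app_face_one_consOne {X : AnMan K} (x : (EPower G 0).sheaf.obj.obj (op X)) :
    app (face 1) (consOne x) = one G X := by
  refine ULift.ext _ _ (power_ext fun i => ?_)
  obtain rfl : i = 0 := Subsingleton.elim (α := Fin 1) _ _
  rfl

theorem cochainsD_zero_apply {A : AbObject G} (ψ : EPower G 0 ⟶ A.toClassifyingTopos) :
    cochainsD A 0 ψ = face 0 ≫ ψ - face 1 ≫ ψ := by
  rw [cochainsD_apply, Fin.sum_univ_two, Fin.val_zero, Fin.val_one, pow_zero, pow_one, one_smul,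
    neg_smul, one_smul, ← sub_eq_add_neg]

theorem app_eq_app_one {A : AbObject G} {ψ : EPower G 0 ⟶ A.toClassifyingTopos}
    (hψ : cochainsD A 0 ψ = 0) {X : AnMan K} (x : (EPower G 0).sheaf.obj.obj (op X)) :
    app ψ x = app ψ (one G X) := by
  have hψ : face 0 ≫ ψ = face 1 ≫ ψ := sub_eq_zero.1 ((cochainsD_zero_apply ψ).symm.trans hψ)
  calc app ψ x = app (face 0 ≫ ψ) (consOne x) := by rw [comp_app, app_face_zero_consOne]
    _ = app (face 1 ≫ ψ) (consOne x) := by rw [hψ]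
    _ = app ψ (one G X) := by rw [comp_app, app_face_one_consOne]

/-- The global section given by a cocycle of degree zero, namely its value at `1`. -/
noncomputable def globalSectionOfCocycle {A : AbObject G} (ψ : EPower G 0 ⟶ A.toClassifyingTopos)
    (hψ : cochainsD A 0 ψ = 0) : terminal G ⟶ A.toClassifyingTopos :=
  homMk' (fun {X} _ => app ψ (one G X)) (fun {X _} f _ => app_map ψ f (one G X))
    fun {X} g _ => (app_eq_app_one hψ _).symm.trans (app_act ψ g (one G X))

theorem augmentation_comp_globalSectionOfCocycle {A : AbObject G}
    {ψ : EPower G 0 ⟶ A.toClassifyingTopos} (hψ : cochainsD A 0 ψ = 0) :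
    augmentation G ≫ globalSectionOfCocycle ψ hψ = ψ :=
  hom_ext' fun {_} x => (app_eq_app_one hψ x).symm

instance : Epi (augmentation G) where
  left_cancellation _ _ h := hom_ext' fun {X} _ => congrArg (fun f => app f (one G X)) h

/-- The augmentation of the complex `Γ(E_• G, A)` by the global sections. -/
noncomputable def cochainsAugmentation (A : AbObject G) :
    (globalSections G).obj A ⟶ ((cochains G).obj A).X 0 :=
  (sections.map (augmentation G).op).app A

theorem cochainsAugmentation_d (A : AbObject G) :
    cochainsAugmentation A ≫ ((cochains G).obj A).d 0 1 = 0 := by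
  refine AddCommGrpCat.hom_ext (AddMonoidHom.ext fun (s : terminal G ⟶ A.toClassifyingTopos) => ?_)
  have faces_eq : face 0 ≫ augmentation G = face 1 ≫ augmentation G :=
    isTerminalTerminal.hom_ext _ _
  refine (cochainsD_zero_apply (augmentation G ≫ s)).trans (sub_eq_zero.2 ?_)
  rw [← Category.assoc, faces_eq, Category.assoc]

instance (A : AbObject G) : Mono (cochainsAugmentation A) :=
  (AddCommGrpCat.mono_iff_injective _).2 fun _ _ => (cancel_epi (augmentation G)).1

theorem exact_cochainsAugmentation (A : AbObject G) :
    (ShortComplex.mk _ _ (cochainsAugmentation_d A)).Exact := by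
  rw [ShortComplex.ab_exact_iff]
  exact fun ψ hψ => ⟨globalSectionOfCocycle ψ hψ, augmentation_comp_globalSectionOfCocycle hψ⟩

/-- The map from global sections to cocycles of degree zero. -/
noncomputable def globalSectionsToCycles (A : AbObject G) :
    (globalSections G).obj A ⟶ ((cochains G).obj A).cycles 0 :=
  HomologicalComplex.liftCycles _ (cochainsAugmentation A) 1 (by simp) (cochainsAugmentation_d A)

theorem globalSectionsToCycles_naturality {A B : AbObject G} (f : A ⟶ B) :
    (globalSections G).map f ≫ globalSectionsToCycles B =
      globalSectionsToCycles A ≫ HomologicalComplex.cyclesMap ((cochains G).map f) 0 := by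
  rw [← cancel_mono (((cochains G).obj B).iCycles 0)]
  simp only [globalSectionsToCycles, Category.assoc, HomologicalComplex.liftCycles_i,
    HomologicalComplex.cyclesMap_i, HomologicalComplex.liftCycles_i_assoc]
  rfl

variable (G) in
/-- The isomorphism `Γ(A) ≅ H^0(Γ(E_• G, A))`, naturally in `A`. -/
noncomputable def globalSectionsIso :
    globalSections G ≅ cochains G ⋙ HomologicalComplex.homologyFunctor _ _ 0 :=
  NatIso.ofComponents
    (fun A =>
      have : IsIso (globalSectionsToCycles A) :=
        (CochainComplex.isIso_liftCycles_iff _ _ _).2 ⟨exact_cochainsAugmentation A, inferInstance⟩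
      asIso (globalSectionsToCycles A) ≪≫ CochainComplex.isoHomologyπ₀ ((cochains G).obj A))
    fun {A B} f => by
      change (globalSections G).map f ≫
          globalSectionsToCycles B ≫ HomologicalComplex.homologyπ _ 0 =
        (globalSectionsToCycles A ≫ HomologicalComplex.homologyπ _ 0) ≫
          HomologicalComplex.homologyMap ((cochains G).map f) 0
      rw [← Category.assoc, globalSectionsToCycles_naturality, Category.assoc, Category.assoc,
        HomologicalComplex.homologyπ_naturality]

end DegreeZero

end AbObject

/-- The isomorphism of right derived functors induced by an isomorphism of functors. -/
noncomputable def rightDerivedMapIso {C D : Type*} [Category* C] [Category* D] [Abelian C]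
    [EnoughInjectives C] [Abelian D] {F F' : C ⥤ D} [F.Additive] [F'.Additive] (e : F ≅ F')
    (n : ℕ) : F.rightDerived n ≅ F'.rightDerived n where
  hom := NatTrans.rightDerived e.hom n
  inv := NatTrans.rightDerived e.inv n
  hom_inv_id := by rw [← NatTrans.rightDerived_comp, e.hom_inv_id, NatTrans.rightDerived_id]
  inv_hom_id := by rw [← NatTrans.rightDerived_comp, e.inv_hom_id, NatTrans.rightDerived_id]

theorem mainTheorem7_general {K : Type u} [NontriviallyNormedField K] [IsUltrametricDist K]
    [CompleteSpace K] (G : AnMan K) [Group G] [LieGroup 𝓘(K, G.model) ω G] (n : ℕ) :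
    Nonempty ((AbObject.globalSections G).rightDerived n ≅ AbObject.cochainCohomology G n) := by
  obtain ⟨cochainsIso⟩ := nonempty_rightDerived_iso (AbObject.cochains G)
    (fun I _ => AbObject.exactAt_cochains_of_injective I) n
  exact ⟨rightDerivedMapIso (AbObject.globalSectionsIso G) n ≪≫ cochainsIso⟩

theorem mainTheorem7 {K : Type u} [NontriviallyNormedField K] [IsUltrametricDist K]
    [CompleteSpace K] [CharZero K] (G : AnMan K) [Group G] [LieGroup 𝓘(K, G.model) ω G] (n : ℕ) :
    Nonempty ((AbObject.globalSections G).rightDerived n ≅ AbObject.cochainCohomology G n) :=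
  mainTheorem7_general G n
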